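/- Let $k$ be a field and let $A=\bigoplus_{m\ge 0}A_m$ be a graded $k$-algebra which is finitely generated as a $k$-algebra and right graded coherent, that is, every finitely generated homogeneous right ideal of $A$ is finitely presented as a right $A$-module. Let $\mathsf{Gr}(A)$ be the abelian category of $\mathbb Z$-graded right $A$-modules and $A$-linear maps of degree zero, and let $\mathsf{gr}(A)$ be its full (abelian) subcategory of finitely presented modules. Call a graded module torsion if it is the sum of its finite-dimensional graded submodules, let $\mathsf{Tors}(A)\subset\mathsf{Gr}(A)$ and $\mathsf{tors}(A)=\mathsf{Tors}(A)\cap\mathsf{gr}(A)\subset\mathsf{gr}(A)$ be the Serre subcategories of torsion modules, and put $\mathsf{Qgr}(A)=\mathsf{Gr}(A)/\mathsf{Tors}(A)$, $\mathsf{qgr}(A)=\mathsf{gr}(A)/\mathsf{tors}(A)$, with quotient functors $\pi\colon\mathsf{Gr}(A)\to\mathsf{Qgr}(A)$ and $p\colon\mathsf{gr}(A)\to\mathsf{qgr}(A)$. An object $X$ of $\mathsf{Qgr}(A)$ is of finite type if every family of subobjects of $X$ with sum $X$ has a finite subfamily with sum $X$; it is finitely presented if it is of finite type and, for every epimorphism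 $q\colon Y\to X$ with $Y$ of finite type, $\ker q$ is of finite type. Let $\mathsf{fp}(\mathsf{Qgr}(A))$ be the full subcategory of finitely presented objects. Then the inclusion $i\colon\mathsf{gr}(A)\to\mathsf{Gr}(A)$ induces an equivalence of categories $\mathsf{qgr}(A)\simeq\mathsf{fp}(\mathsf{Qgr}(A))$: there is an equivalence $E\colon\mathsf{qgr}(A)\to\mathsf{fp}(\mathsf{Qgr}(A))$ such that the composite of $E\circ p$ with the inclusion $\mathsf{fp}(\mathsf{Qgr}(A))\to\mathsf{Qgr}(A)$ is naturally isomorphic to $\pi\circ i$. -/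

import Mathlib

open CategoryTheory CategoryTheory.Limits MulOpposite DirectSum

universe w u

section GradedModules

variable {k : Type w} [Field k] {A : Type u} [Ring A] [Algebra k A]

/-- A `ℤ`-graded right module over the graded `k`-algebra `A = ⨁ 𝒜 m`.  Right `A`-modules are
modules over `Aᵐᵒᵖ`; the homogeneous components are `k`-subspaces. -/
structure GrMod (𝒜 : ℕ → Submodule k A) where
  carrier : Type u
  [addCommGroup : AddCommGroup carrier]
  [moduleBase : Module k carrier]
  [module : Module Aᵐᵒᵖ carrier]
  [isScalarTower : IsScalarTower k Aᵐᵒᵖ carrier]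
  deg : ℤ → Submodule k carrier
  isInternal : DirectSum.IsInternal deg
  smul_mem : ∀ {m : ℕ} {i : ℤ} {a : A} {x : carrier},
    a ∈ 𝒜 m → x ∈ deg i → op a • x ∈ deg (i + m)

namespace GrMod

variable {𝒜 : ℕ → Submodule k A}

instance : CoeSort (GrMod 𝒜) (Type u) := ⟨GrMod.carrier⟩

attribute [instance] addCommGroup moduleBase module isScalarTower

noncomputable instance (M : GrMod 𝒜) : DirectSum.Decomposition M.deg :=
  M.isInternal.chooseDecomposition

/-- Morphisms of graded modules: `A`-linear maps of degree zero. -/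
@[ext]
structure Hom (M N : GrMod 𝒜) where
  lin : M →ₗ[Aᵐᵒᵖ] N
  map_mem : ∀ (i : ℤ) (x : M), x ∈ M.deg i → lin x ∈ N.deg i

/-- The category `Gr(A)` of `ℤ`-graded right `A`-modules. -/
instance : Category (GrMod 𝒜) where
  Hom M N := Hom M N
  id M := ⟨LinearMap.id, fun _ _ h => h⟩
  comp f g := ⟨g.lin ∘ₗ f.lin, fun i x h => g.map_mem i _ (f.map_mem i x h)⟩

@[ext]
lemma hom_ext {M N : GrMod 𝒜} {f g : M ⟶ N} (h : ∀ x, f.lin x = g.lin x) : f = g :=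
  Hom.ext (LinearMap.ext h)

@[simp] lemma id_lin (M : GrMod 𝒜) : (𝟙 M : M ⟶ M).lin = LinearMap.id := rfl

@[simp] lemma comp_lin {M N P : GrMod 𝒜} (f : M ⟶ N) (g : N ⟶ P) :
    (f ≫ g).lin = g.lin ∘ₗ f.lin := rfl

section Preadditive

variable (M N : GrMod 𝒜)

instance : Zero (M ⟶ N) := ⟨⟨0, fun i _ _ => (N.deg i).zero_mem⟩⟩
instance : Add (M ⟶ N) :=
  ⟨fun f g => ⟨f.lin + g.lin, fun i x h => (N.deg i).add_mem (f.map_mem i x h) (g.map_mem i x h)⟩⟩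
instance : Neg (M ⟶ N) :=
  ⟨fun f => ⟨-f.lin, fun i x h => (N.deg i).neg_mem (f.map_mem i x h)⟩⟩
instance : Sub (M ⟶ N) :=
  ⟨fun f g => ⟨f.lin - g.lin, fun i x h => (N.deg i).sub_mem (f.map_mem i x h) (g.map_mem i x h)⟩⟩
instance : SMul ℕ (M ⟶ N) :=
  ⟨fun n f => ⟨n • f.lin, fun i x h => nsmul_mem (f.map_mem i x h) n⟩⟩
instance : SMul ℤ (M ⟶ N) :=
  ⟨fun n f => ⟨n • f.lin, fun i x h => zsmul_mem (f.map_mem i x h) n⟩⟩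

lemma lin_injective : Function.Injective (fun f : M ⟶ N => f.lin) := fun _ _ h => Hom.ext h

instance : AddCommGroup (M ⟶ N) :=
  (lin_injective M N).addCommGroup _ rfl (fun _ _ => rfl) (fun _ => rfl) (fun _ _ => rfl)
    (fun _ _ => rfl) (fun _ _ => rfl)

variable {M N}

@[simp] lemma zero_lin : (0 : M ⟶ N).lin = 0 := rfl
@[simp] lemma add_lin (f g : M ⟶ N) : (f + g).lin = f.lin + g.lin := rfl
@[simp] lemma sub_lin (f g : M ⟶ N) : (f - g).lin = f.lin - g.lin := rfl

instance : Preadditive (GrMod 𝒜) where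
  add_comp _ _ _ f f' g := by ext x; simp
  comp_add _ _ _ f g g' := by ext x; simp

end Preadditive

lemma isInternal_of_proj {M M' : Type*} [AddCommGroup M] [Module k M] [AddCommGroup M']
    [Module k M'] (D : ℤ → Submodule k M) (p : ℤ → M →ₗ[k] M')
    (h₁ : ∀ i x, x ∈ D i → p i x = 0 → x = 0)
    (h₂ : ∀ i j x, i ≠ j → x ∈ D j → p i x = 0)
    (h₃ : ∀ x, x ∈ ⨆ i, D i) : DirectSum.IsInternal D := by
  rw [DirectSum.isInternal_submodule_iff_iSupIndep_and_iSup_eq_top]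
  refine ⟨fun i => ?_, eq_top_iff.2 fun x _ => h₃ x⟩
  rw [Submodule.disjoint_def]
  intro x hx hx'
  refine h₁ i x hx ?_
  have : (⨆ j, ⨆ (_ : j ≠ i), D j) ≤ LinearMap.ker (p i) :=
    iSup₂_le fun j hj y hy => h₂ i j y hj.symm hy
  exact this hx'

/-- The projection of a graded module to its component of degree `i`. -/
noncomputable def proj (M : GrMod 𝒜) (i : ℤ) : M →ₗ[k] M :=
  (M.deg i).subtype ∘ₗ DirectSum.component k ℤ (fun i => M.deg i) i ∘ₗ
    (DirectSum.decomposeLinearEquiv M.deg).toLinearMap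

lemma proj_apply (M : GrMod 𝒜) (i : ℤ) (x : M) :
    M.proj i x = (DirectSum.decompose M.deg x i : M) := rfl

lemma proj_mem (M : GrMod 𝒜) (i : ℤ) (x : M) : M.proj i x ∈ M.deg i :=
  (DirectSum.decompose M.deg x i).2

lemma proj_of_mem {M : GrMod 𝒜} {i : ℤ} {x : M} (h : x ∈ M.deg i) : M.proj i x = x :=
  DirectSum.decompose_of_mem_same _ h

lemma proj_of_mem_ne {M : GrMod 𝒜} {i j : ℤ} {x : M} (hij : i ≠ j) (h : x ∈ M.deg j) :
    M.proj i x = 0 :=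
  DirectSum.decompose_of_mem_ne _ h hij.symm

lemma exists_eq_sum_proj (M : GrMod 𝒜) (x : M) : ∃ s : Finset ℤ, ∑ i ∈ s, M.proj i x = x := by
  classical
  exact ⟨_, DirectSum.sum_support_decompose M.deg x⟩

lemma hom_induction {M : GrMod 𝒜} {p : M → Prop} (x : M) (h0 : p 0)
    (hadd : ∀ x y, p x → p y → p (x + y)) (hd : ∀ i, ∀ x ∈ M.deg i, p x) : p x := by
  obtain ⟨s, hs⟩ := M.exists_eq_sum_proj x
  rw [← hs]
  exact Finset.sum_induction _ p hadd h0 fun i _ => hd i _ (M.proj_mem i x)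

lemma map_proj {M N : GrMod 𝒜} (f : M ⟶ N) (i : ℤ) (x : M) :
    f.lin (M.proj i x) = N.proj i (f.lin x) := by
  refine hom_induction (p := fun x => f.lin (M.proj i x) = N.proj i (f.lin x)) x (by simp)
    (fun x y hx hy => by simp [hx, hy]) fun j x hx => ?_
  by_cases hij : i = j
  · subst hij
    rw [proj_of_mem hx, proj_of_mem (f.map_mem _ _ hx)]
  · rw [proj_of_mem_ne hij hx, proj_of_mem_ne hij (f.map_mem _ _ hx), map_zero]

lemma proj_smul {M : GrMod 𝒜} {m : ℕ} {a : A} (ha : a ∈ 𝒜 m) (i : ℤ) (x : M) :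
    M.proj i (op a • x) = op a • M.proj (i - m) x := by
  refine hom_induction (p := fun x => M.proj i (op a • x) = op a • M.proj (i - m) x) x (by simp)
    (fun x y hx hy => by simp [hx, hy]) fun j x hx => ?_
  by_cases hij : i = j + m
  · subst hij
    rw [proj_of_mem (M.smul_mem ha hx), add_sub_cancel_right, proj_of_mem hx]
  · rw [proj_of_mem_ne hij (M.smul_mem ha hx), proj_of_mem_ne (fun h => hij (by omega)) hx,
      smul_zero]

/-! ### Graded submodules and quotients -/

/-- A submodule of a graded module is homogeneous (a graded submodule) if it contains the
homogeneous components of its elements. -/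
abbrev IsHomog (M : GrMod 𝒜) (N : Submodule Aᵐᵒᵖ M) : Prop := N.IsHomogeneous M.deg

lemma IsHomog.proj_mem {M : GrMod 𝒜} {N : Submodule Aᵐᵒᵖ M} (h : M.IsHomog N) {x : M}
    (hx : x ∈ N) (i : ℤ) : M.proj i x ∈ N := h i hx

lemma isHomog_ker {M N : GrMod 𝒜} (f : M ⟶ N) : M.IsHomog (LinearMap.ker f.lin) := by
  intro i x hx
  change f.lin (M.proj i x) = 0
  rw [map_proj, show f.lin x = 0 from hx, map_zero]

lemma IsHomog.map {M N : GrMod 𝒜} (f : M ⟶ N) {P : Submodule Aᵐᵒᵖ M} (hP : M.IsHomog P) :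
    N.IsHomog (P.map f.lin) := by
  rintro i _ ⟨x, hx, rfl⟩
  exact ⟨M.proj i x, hP i hx, map_proj f i x⟩

lemma IsHomog.comap {M N : GrMod 𝒜} (f : M ⟶ N) {P : Submodule Aᵐᵒᵖ N} (hP : N.IsHomog P) :
    M.IsHomog (P.comap f.lin) := by
  intro i x hx
  change f.lin (M.proj i x) ∈ P
  rw [map_proj]
  exact hP i hx

lemma isHomog_top (M : GrMod 𝒜) : M.IsHomog ⊤ := fun _ _ _ => trivial

lemma isHomog_range {M N : GrMod 𝒜} (f : M ⟶ N) : N.IsHomog (LinearMap.range f.lin) := by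
  rw [← Submodule.map_top]
  exact (isHomog_top M).map f

/-- A homogeneous submodule as a graded module. -/
def sub (M : GrMod 𝒜) (N : Submodule Aᵐᵒᵖ M) (hN : M.IsHomog N) : GrMod 𝒜 where
  carrier := N
  deg i := (M.deg i).comap (N.subtype.restrictScalars k)
  isInternal := by
    refine isInternal_of_proj _ (fun i => M.proj i ∘ₗ N.subtype.restrictScalars k) ?_ ?_ ?_
    · intro i x hx h
      have : M.proj i (x : M) = x := proj_of_mem hx
      exact Subtype.ext (this.symm.trans h)
    · intro i j x hij hx
      exact proj_of_mem_ne (x := (x : M)) hij hx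
    · intro x
      obtain ⟨s, hs⟩ := M.exists_eq_sum_proj x
      have : x = ∑ i ∈ s, (⟨M.proj i x, hN.proj_mem x.2 i⟩ : N) := by
        ext; simpa using hs.symm
      rw [this]
      exact Submodule.sum_mem _ fun i _ => Submodule.mem_iSup_of_mem i (M.proj_mem i x)
  smul_mem ha hx := M.smul_mem ha hx

/-- The inclusion of a homogeneous submodule. -/
def subι (M : GrMod 𝒜) (N : Submodule Aᵐᵒᵖ M) (hN : M.IsHomog N) : M.sub N hN ⟶ M :=
  ⟨N.subtype, fun _ _ h => h⟩

/-- The quotient of a graded module by a homogeneous submodule. -/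
def quot (M : GrMod 𝒜) (N : Submodule Aᵐᵒᵖ M) (hN : M.IsHomog N) : GrMod 𝒜 where
  carrier := M ⧸ N
  deg i := (M.deg i).map (N.mkQ.restrictScalars k)
  isInternal := by
    have key : ∀ i, N.restrictScalars k ≤
        LinearMap.ker (N.mkQ.restrictScalars k ∘ₗ M.proj i) := fun i x hx => by
      simpa using hN.proj_mem hx i
    refine isInternal_of_proj _
      (fun i => (N.restrictScalars k).liftQ (N.mkQ.restrictScalars k ∘ₗ M.proj i) (key i)) ?_ ?_ ?_
    · rintro i _ ⟨x, hx, rfl⟩ h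
      have h' : N.mkQ (M.proj i x) = 0 := h
      rw [proj_of_mem hx] at h'
      exact h'
    · rintro i j _ hij ⟨x, hx, rfl⟩
      change N.mkQ (M.proj i x) = 0
      rw [proj_of_mem_ne hij hx, map_zero]
    · intro x
      obtain ⟨x, rfl⟩ := N.mkQ_surjective x
      obtain ⟨s, hs⟩ := M.exists_eq_sum_proj x
      rw [← hs, map_sum]
      exact Submodule.sum_mem _ fun i _ =>
        Submodule.mem_iSup_of_mem i ⟨_, M.proj_mem i x, rfl⟩
  smul_mem := by
    rintro m i a _ ha ⟨x, hx, rfl⟩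
    exact ⟨op a • x, M.smul_mem ha hx, rfl⟩

/-- The projection to the quotient by a homogeneous submodule. -/
def quotπ (M : GrMod 𝒜) (N : Submodule Aᵐᵒᵖ M) (hN : M.IsHomog N) : M ⟶ M.quot N hN :=
  ⟨N.mkQ, fun _ x h => ⟨x, h, rfl⟩⟩

/-- The direct sum of two graded modules. -/
def prod (M N : GrMod 𝒜) : GrMod 𝒜 where
  carrier := M × N
  deg i := (M.deg i).prod (N.deg i)
  isInternal := by
    refine isInternal_of_proj _ (fun i => (M.proj i).prodMap (N.proj i)) ?_ ?_ ?_
    · rintro i ⟨x, y⟩ ⟨hx, hy⟩ h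
      have h₁ : M.proj i x = 0 := congrArg Prod.fst h
      have h₂ : N.proj i y = 0 := congrArg Prod.snd h
      rw [proj_of_mem hx] at h₁
      rw [proj_of_mem hy] at h₂
      exact Prod.ext h₁ h₂
    · rintro i j ⟨x, y⟩ hij ⟨hx, hy⟩
      exact Prod.ext (proj_of_mem_ne hij hx) (proj_of_mem_ne hij hy)
    · rintro ⟨x, y⟩
      have hx : ((x, 0) : M × N) ∈ ⨆ i, (M.deg i).prod (N.deg i) := by
        obtain ⟨s, hs⟩ := M.exists_eq_sum_proj x
        have : ((x, 0) : M × N) = ∑ i ∈ s, (M.proj i x, 0) := by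
          ext <;> simp [Prod.fst_sum, Prod.snd_sum, hs]
        rw [this]
        exact Submodule.sum_mem _ fun i _ =>
          Submodule.mem_iSup_of_mem i ⟨M.proj_mem i x, (N.deg i).zero_mem⟩
      have hy : ((0, y) : M × N) ∈ ⨆ i, (M.deg i).prod (N.deg i) := by
        obtain ⟨s, hs⟩ := N.exists_eq_sum_proj y
        have : ((0, y) : M × N) = ∑ i ∈ s, (0, N.proj i y) := by
          ext <;> simp [Prod.fst_sum, Prod.snd_sum, hs]
        rw [this]
        exact Submodule.sum_mem _ fun i _ =>
          Submodule.mem_iSup_of_mem i ⟨(M.deg i).zero_mem, N.proj_mem i y⟩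
      simpa using add_mem hx hy
  smul_mem ha hx := ⟨M.smul_mem ha hx.1, N.smul_mem ha hx.2⟩

/-- The zero graded module. -/
def zero (𝒜 : ℕ → Submodule k A) : GrMod 𝒜 where
  carrier := PUnit
  deg _ := ⊥
  isInternal := isInternal_of_proj (M' := PUnit.{1}) _ (fun _ => 0) (fun _ _ _ _ => rfl)
    (fun _ _ _ _ _ => rfl) (fun x => by
      rw [Subsingleton.elim x 0]; exact Submodule.zero_mem _)
  smul_mem _ _ := Subsingleton.elim _ _

/-! ### The abelian structure -/

section Abelian

lemma isZero_zero : IsZero (zero 𝒜) := by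
  rw [IsZero.iff_id_eq_zero]
  ext x
  exact Subsingleton.elim (α := PUnit) _ _

instance : HasZeroObject (GrMod 𝒜) := ⟨_, isZero_zero⟩

variable {M N : GrMod 𝒜} (f : M ⟶ N)

/-- Lift of a morphism to a homogeneous submodule. -/
def subLift {T : GrMod 𝒜} (g : T ⟶ M) (P : Submodule Aᵐᵒᵖ M) (hP : M.IsHomog P)
    (h : ∀ x, g.lin x ∈ P) : T ⟶ M.sub P hP :=
  ⟨g.lin.codRestrict P h, fun i x hx => g.map_mem i x hx⟩

/-- Descent of a morphism to the quotient by a homogeneous submodule. -/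
def quotDesc {T : GrMod 𝒜} (g : M ⟶ T) (P : Submodule Aᵐᵒᵖ M) (hP : M.IsHomog P)
    (h : ∀ x ∈ P, g.lin x = 0) : M.quot P hP ⟶ T :=
  ⟨P.liftQ g.lin h, by rintro i _ ⟨x, hx, rfl⟩; exact g.map_mem i x hx⟩

lemma subι_lin_apply (P : Submodule Aᵐᵒᵖ M) (hP : M.IsHomog P) (x : P) :
    (M.subι P hP).lin x = (x : M) := rfl

/-- The kernel of a morphism, with its universal property. -/
def kernelIsLimit : IsLimit (KernelFork.ofι (f := f) (M.subι _ (isHomog_ker f))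
    (by ext x; exact x.2)) :=
  KernelFork.IsLimit.ofι _ _
    (fun g hg => subLift g _ _ fun x => congrArg (fun h => Hom.lin h x) hg)
    (fun _ _ => rfl)
    (fun g hg m hm => by
      ext x
      exact Subtype.ext (congrArg (fun h => Hom.lin h x) hm))

/-- The cokernel of a morphism, with its universal property. -/
def cokernelIsColimit : IsColimit (CokernelCofork.ofπ (f := f) (N.quotπ _ (isHomog_range f))
    (by ext x; exact (Submodule.Quotient.mk_eq_zero _).2 ⟨x, rfl⟩)) :=
  CokernelCofork.IsColimit.ofπ _ _
    (fun g hg => quotDesc g _ _ (by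
      rintro _ ⟨x, rfl⟩
      exact congrArg (fun h => Hom.lin h x) hg))
    (fun _ _ => rfl)
    (fun g hg m hm => by
      ext x
      obtain ⟨x, rfl⟩ := Submodule.mkQ_surjective _ x
      exact congrArg (fun h => Hom.lin h x) hm)

instance : HasKernels (GrMod 𝒜) := ⟨fun f => ⟨⟨_, kernelIsLimit f⟩⟩⟩

instance : HasCokernels (GrMod 𝒜) := ⟨fun f => ⟨⟨_, cokernelIsColimit f⟩⟩⟩

/-- The universal property of the direct sum. -/
def prodIsLimit (M N : GrMod 𝒜) : IsLimit (BinaryFan.mk (P := M.prod N)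
    (⟨LinearMap.fst _ _ _, fun _ _ h => h.1⟩ : M.prod N ⟶ M)
    (⟨LinearMap.snd _ _ _, fun _ _ h => h.2⟩ : M.prod N ⟶ N)) :=
  BinaryFan.IsLimit.mk _
    (fun f g => ⟨f.lin.prod g.lin, fun i x h => ⟨f.map_mem i x h, g.map_mem i x h⟩⟩)
    (fun _ _ => rfl) (fun _ _ => rfl)
    (fun f g m h₁ h₂ => by
      ext x
      exact Prod.ext (congrArg (fun h => Hom.lin h x) h₁) (congrArg (fun h => Hom.lin h x) h₂))

instance : HasBinaryProducts (GrMod 𝒜) :=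
  have (M N : GrMod 𝒜) : HasLimit (pair M N) := ⟨⟨_, prodIsLimit M N⟩⟩
  hasBinaryProducts_of_hasLimit_pair _

instance : HasFiniteProducts (GrMod 𝒜) :=
  hasFiniteProducts_of_has_binary_and_terminal

lemma injective_of_mono [Mono f] : Function.Injective f.lin := by
  rw [← LinearMap.ker_eq_bot, eq_bot_iff]
  intro x hx
  have h : M.subι _ (isHomog_ker f) = 0 := by
    rw [← cancel_mono f, zero_comp]
    ext y
    exact y.2
  exact congrArg (fun g => Hom.lin g (⟨x, hx⟩ : LinearMap.ker f.lin)) h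

lemma surjective_of_epi [Epi f] : Function.Surjective f.lin := by
  rw [← LinearMap.range_eq_top, eq_top_iff]
  intro x _
  have h : N.quotπ _ (isHomog_range f) = 0 := by
    rw [← cancel_epi f, comp_zero]
    ext y
    exact (Submodule.Quotient.mk_eq_zero _).2 ⟨y, rfl⟩
  exact (Submodule.Quotient.mk_eq_zero _).1 (congrArg (fun g => Hom.lin g x) h)

lemma mem_deg_of_injective (hf : Function.Injective f.lin) {i : ℤ} {x : M}
    (hx : f.lin x ∈ N.deg i) : x ∈ M.deg i := by
  have : x = M.proj i x := hf (by rw [map_proj, proj_of_mem hx])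
  rw [this]
  exact M.proj_mem i x

/-- Lift of a morphism through an injective morphism. -/
noncomputable def monoLift (hf : Function.Injective f.lin) {T : GrMod 𝒜} (g : T ⟶ N)
    (hr : ∀ x, g.lin x ∈ LinearMap.range f.lin) : T ⟶ M :=
  ⟨(LinearEquiv.ofInjective f.lin hf).symm.toLinearMap ∘ₗ g.lin.codRestrict _ hr, fun i x hx =>
    mem_deg_of_injective f hf (by
      have h : f.lin ((LinearEquiv.ofInjective f.lin hf).symm (g.lin.codRestrict _ hr x)) =
          g.lin x :=
        congrArg Subtype.val ((LinearEquiv.ofInjective f.lin hf).apply_symm_apply _)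
      rw [LinearMap.comp_apply, LinearEquiv.coe_coe, h]
      exact g.map_mem i x hx)⟩

lemma monoLift_comp (hf : Function.Injective f.lin) {T : GrMod 𝒜} (g : T ⟶ N)
    (hr : ∀ x, g.lin x ∈ LinearMap.range f.lin) : monoLift f hf g hr ≫ f = g := by
  ext x
  exact congrArg Subtype.val ((LinearEquiv.ofInjective f.lin hf).apply_symm_apply _)

lemma exists_mem_deg_of_surjective (hf : Function.Surjective f.lin) {i : ℤ} {y : N}
    (hy : y ∈ N.deg i) : ∃ x ∈ M.deg i, f.lin x = y := by
  obtain ⟨x, rfl⟩ := hf y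
  exact ⟨M.proj i x, M.proj_mem i x, by rw [map_proj, proj_of_mem hy]⟩

/-- Descent of a morphism along a surjective morphism. -/
noncomputable def epiDesc (hf : Function.Surjective f.lin) {T : GrMod 𝒜} (g : M ⟶ T)
    (hk : LinearMap.ker f.lin ≤ LinearMap.ker g.lin) : N ⟶ T :=
  ⟨(LinearMap.ker f.lin).liftQ g.lin hk ∘ₗ
      (f.lin.quotKerEquivOfSurjective hf).symm.toLinearMap, by
    intro i y hy
    obtain ⟨x, hx, rfl⟩ := exists_mem_deg_of_surjective f hf hy
    have h : (f.lin.quotKerEquivOfSurjective hf).symm (f.lin x) =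
        (LinearMap.ker f.lin).mkQ x := by
      rw [LinearEquiv.symm_apply_eq]; rfl
    rw [LinearMap.comp_apply, LinearEquiv.coe_coe, h]
    exact g.map_mem i x hx⟩

lemma comp_epiDesc (hf : Function.Surjective f.lin) {T : GrMod 𝒜} (g : M ⟶ T)
    (hk : LinearMap.ker f.lin ≤ LinearMap.ker g.lin) : f ≫ epiDesc f hf g hk = g := by
  ext x
  have h : (f.lin.quotKerEquivOfSurjective hf).symm (f.lin x) =
      (LinearMap.ker f.lin).mkQ x := by
    rw [LinearEquiv.symm_apply_eq]; rfl
  change (LinearMap.ker f.lin).liftQ g.lin hk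
    ((f.lin.quotKerEquivOfSurjective hf).symm (f.lin x)) = g.lin x
  rw [h]
  rfl

/-- Every monomorphism of graded modules is the kernel of its cokernel. -/
instance : IsNormalMonoCategory (GrMod 𝒜) := ⟨fun {M N} f _ => ⟨{
  Z := N.quot _ (isHomog_range f)
  g := N.quotπ _ (isHomog_range f)
  w := by ext x; exact (Submodule.Quotient.mk_eq_zero _).2 ⟨x, rfl⟩
  isLimit := KernelFork.IsLimit.ofι _ _
    (fun {T} g hg => monoLift f (injective_of_mono f) g fun x =>
      (Submodule.Quotient.mk_eq_zero _).1 (congrArg (fun h => Hom.lin h x) hg))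
    (fun g hg => monoLift_comp f _ g _)
    (fun g hg m hm => by rw [← cancel_mono f, hm, monoLift_comp]) }⟩⟩

/-- Every epimorphism of graded modules is the cokernel of its kernel. -/
instance : IsNormalEpiCategory (GrMod 𝒜) := ⟨fun {M N} f _ => ⟨{
  W := M.sub _ (isHomog_ker f)
  g := M.subι _ (isHomog_ker f)
  w := by ext x; exact x.2
  isColimit := CokernelCofork.IsColimit.ofπ _ _
    (fun {T} g hg => epiDesc f (surjective_of_epi f) g fun x hx =>
      LinearMap.congr_fun (congrArg Hom.lin hg) (⟨x, hx⟩ : LinearMap.ker f.lin))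
    (fun g hg => comp_epiDesc f _ g _)
    (fun g hg m hm => by rw [← cancel_epi f]; exact hm.trans (comp_epiDesc f _ g _).symm) }⟩⟩

/-- `Gr(A)` is an abelian category. -/
instance : Abelian (GrMod 𝒜) where

end Abelian

/-! ### Torsion modules -/

section Torsion

/-- A graded module is torsion if it is the sum of its finite-dimensional graded submodules. -/
def IsTorsion (M : GrMod 𝒜) : Prop :=
  sSup {N : Submodule Aᵐᵒᵖ M | M.IsHomog N ∧ Module.Finite k N} = ⊤

lemma finite_of_le {M : GrMod 𝒜} {N P : Submodule Aᵐᵒᵖ M} (h : N ≤ P) [Module.Finite k P] :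
    Module.Finite k N :=
  Module.Finite.of_injective ((Submodule.inclusion h).restrictScalars k)
    (Submodule.inclusion_injective h)

lemma finite_sup {M : GrMod 𝒜} (N P : Submodule Aᵐᵒᵖ M) [Module.Finite k N] [Module.Finite k P] :
    Module.Finite k (N ⊔ P : Submodule Aᵐᵒᵖ M) := by
  let f : N × P →ₗ[k] (N ⊔ P : Submodule Aᵐᵒᵖ M) :=
    ((Submodule.inclusion (le_sup_left : N ≤ N ⊔ P)).coprod
      (Submodule.inclusion (le_sup_right : P ≤ N ⊔ P))).restrictScalars k
  refine Module.Finite.of_surjective f ?_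
  rintro ⟨x, hx⟩
  obtain ⟨y, hy, z, hz, rfl⟩ := Submodule.mem_sup.1 hx
  exact ⟨(⟨y, hy⟩, ⟨z, hz⟩), rfl⟩

/-- If `A` is finitely generated and a finite-dimensional subspace `V` of a module is mapped
into `V + K` by the generators of `A`, for a submodule `K`, then `V + U` is stable under `A`
for some finitely generated submodule `U` of `K`. -/
lemma exists_stable (M : GrMod 𝒜) (s : Finset A) (hs : Algebra.adjoin k (s : Set A) = ⊤)
    (K : Submodule Aᵐᵒᵖ M) (V : Submodule k M) (hV : V.FG)
    (h : ∀ a ∈ s, ∀ v ∈ V, ∃ u ∈ K, op a • v - u ∈ V) :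
    ∃ U : Submodule Aᵐᵒᵖ M, U.FG ∧ U ≤ K ∧
      ∀ (a : A), ∀ v ∈ V ⊔ U.restrictScalars k, op a • v ∈ V ⊔ U.restrictScalars k := by
  classical
  obtain ⟨b, rfl⟩ := hV
  choose! u hu huV using h
  have hb : ∀ v ∈ b, v ∈ Submodule.span k (b : Set M) := fun v hv => Submodule.subset_span hv
  let T : Finset M := (s ×ˢ b).image fun p => u p.1 p.2
  refine ⟨Submodule.span Aᵐᵒᵖ T, ⟨T, rfl⟩, ?_, ?_⟩
  · rw [Submodule.span_le]
    intro y hy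
    obtain ⟨p, hp, rfl⟩ := Finset.mem_image.1 (Finset.mem_coe.1 hy)
    rw [Finset.mem_product] at hp
    exact hu _ hp.1 _ (hb _ hp.2)
  · intro a
    set W := Submodule.span k (b : Set M) ⊔ (Submodule.span Aᵐᵒᵖ (T : Set M)).restrictScalars k
    have ha : a ∈ Algebra.adjoin k (s : Set A) := by rw [hs]; trivial
    induction ha using Algebra.adjoin_induction with
    | mem a ha =>
      intro v hv
      obtain ⟨y, hy, z, hz, rfl⟩ := Submodule.mem_sup.1 hv
      rw [smul_add]
      refine add_mem ?_ (Submodule.mem_sup_right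
        ((Submodule.span Aᵐᵒᵖ (T : Set M)).smul_mem (op a) hz))
      induction hy using Submodule.span_induction with
      | mem y hy =>
        have : op a • y = (op a • y - u a y) + u a y := by abel
        rw [this]
        refine add_mem (Submodule.mem_sup_left (huV a ha y (hb y hy)))
          (Submodule.mem_sup_right (Submodule.subset_span ?_))
        exact Finset.mem_coe.2 (Finset.mem_image.2 ⟨(a, y), Finset.mem_product.2 ⟨ha, hy⟩, rfl⟩)
      | zero => simp
      | add y y' hy₀ hy₀' hy hy' =>
        rw [smul_add]
        exact add_mem (hy (add_mem (Submodule.mem_sup_left hy₀) (Submodule.mem_sup_right hz)))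
          (hy' (add_mem (Submodule.mem_sup_left hy₀') (Submodule.mem_sup_right hz)))
      | smul c y hy₀ hy =>
        rw [smul_comm]
        exact Submodule.smul_mem _ _
          (hy (add_mem (Submodule.mem_sup_left hy₀) (Submodule.mem_sup_right hz)))
    | algebraMap c =>
      intro v hv
      have : op (algebraMap k A c) • v = c • v := by
        rw [← MulOpposite.algebraMap_apply, algebraMap_smul]
      rw [this]
      exact Submodule.smul_mem _ _ hv
    | add a a' _ _ ha ha' =>
      intro v hv
      rw [MulOpposite.op_add, add_smul]
      exact add_mem (ha v hv) (ha' v hv)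
    | mul a a' _ _ ha ha' =>
      intro v hv
      rw [MulOpposite.op_mul, mul_smul]
      exact ha' _ (ha v hv)

lemma exact_apply {S : ShortComplex (GrMod 𝒜)} (hS : S.ShortExact) (x : S.X₂)
    (hx : S.g.lin x = 0) : ∃ y, S.f.lin y = x := by
  have := hS.mono_f
  obtain ⟨l, hl⟩ := KernelFork.IsLimit.lift' hS.fIsKernel (S.X₂.subι _ (isHomog_ker S.g))
    (by ext y; exact y.2)
  exact ⟨l.lin (⟨x, hx⟩ : LinearMap.ker S.g.lin),
    LinearMap.congr_fun (congrArg Hom.lin hl) (⟨x, hx⟩ : LinearMap.ker S.g.lin)⟩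

variable [GradedAlgebra 𝒜]

lemma isHomog_span_singleton {M : GrMod 𝒜} {i : ℤ} {x : M} (hx : x ∈ M.deg i) :
    M.IsHomog (Submodule.span Aᵐᵒᵖ {x}) := by
  intro j y hy
  obtain ⟨a, rfl⟩ := Submodule.mem_span_singleton.1 hy
  change M.proj j (a • x) ∈ _
  induction a using MulOpposite.rec' with
  | h a =>
    refine DirectSum.Decomposition.inductionOn 𝒜
      (motive := fun a => M.proj j (op a • x) ∈ Submodule.span Aᵐᵒᵖ {x}) (by simp) ?_ ?_ a
    · intro m a
      rw [proj_smul a.2]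
      refine Submodule.smul_mem _ _ ?_
      by_cases h : j - m = i
      · rw [h, proj_of_mem hx]; exact Submodule.mem_span_singleton_self x
      · rw [proj_of_mem_ne h hx]; exact Submodule.zero_mem _
    · intro a b ha hb
      rw [MulOpposite.op_add, add_smul, map_add]
      exact Submodule.add_mem _ ha hb

lemma isTorsion_iff (M : GrMod 𝒜) :
    M.IsTorsion ↔ ∀ x : M, Module.Finite k (Submodule.span Aᵐᵒᵖ {x}) := by
  constructor
  · intro h x
    have hx : x ∈ sSup {N : Submodule Aᵐᵒᵖ M | M.IsHomog N ∧ Module.Finite k N} := by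
      rw [show sSup _ = _ from h]; trivial
    rw [sSup_eq_iSup'] at hx
    refine Submodule.iSup_induction _
      (motive := fun x => Module.Finite k (Submodule.span Aᵐᵒᵖ {x})) hx ?_ ?_ ?_
    · rintro ⟨N, hN, hN'⟩ x hx
      exact finite_of_le (P := N) ((Submodule.span_singleton_le_iff_mem _ _).2 hx)
    · rw [Submodule.span_zero_singleton]
      infer_instance
    · intro x y hx hy
      have := finite_sup (Submodule.span Aᵐᵒᵖ {x}) (Submodule.span Aᵐᵒᵖ {y})
      refine finite_of_le (P := Submodule.span Aᵐᵒᵖ {x} ⊔ Submodule.span Aᵐᵒᵖ {y}) ?_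
      rw [Submodule.span_singleton_le_iff_mem]
      exact add_mem (Submodule.mem_sup_left (Submodule.mem_span_singleton_self x))
        (Submodule.mem_sup_right (Submodule.mem_span_singleton_self y))
  · intro h
    refine eq_top_iff.2 fun x _ => ?_
    refine hom_induction (p := fun x => x ∈
      sSup {N : Submodule Aᵐᵒᵖ M | M.IsHomog N ∧ Module.Finite k N}) x (Submodule.zero_mem _)
      (fun x y hx hy => Submodule.add_mem _ hx hy) fun i x hx => ?_
    exact (le_sSup (show Submodule.span Aᵐᵒᵖ {x} ∈ {N : Submodule Aᵐᵒᵖ M | M.IsHomog N ∧ Module.Finite k N}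
      from ⟨isHomog_span_singleton hx, h x⟩))
      (Submodule.mem_span_singleton_self x)

lemma IsTorsion.finite_of_fg {M : GrMod 𝒜} (hM : M.IsTorsion) {U : Submodule Aᵐᵒᵖ M}
    (hU : U.FG) : Module.Finite k U := by
  rw [isTorsion_iff] at hM
  induction U, hU using Submodule.fg_induction with
  | singleton x => exact hM x
  | sup N P hN hP => exact finite_sup N P

variable (𝒜) in
/-- The full subcategory `Tors(A)` of torsion modules in `Gr(A)`. -/
def Tors : ObjectProperty (GrMod 𝒜) := fun M => M.IsTorsion

/-- For a finitely generated algebra `A`, the torsion modules form a Serre subcategory. -/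
instance [Algebra.FiniteType k A] : (Tors 𝒜).IsSerreClass where
  exists_zero := by
    refine ⟨zero 𝒜, isZero_zero, (isTorsion_iff _).2 fun x => ?_⟩
    rw [show x = 0 from Subsingleton.elim (α := PUnit) _ _, Submodule.span_zero_singleton]
    infer_instance
  prop_of_mono {X Y} f _ hY := by
    refine (isTorsion_iff X).2 fun x => ?_
    have := (isTorsion_iff Y).1 hY (f.lin x)
    let g : Submodule.span Aᵐᵒᵖ {x} →ₗ[Aᵐᵒᵖ] Submodule.span Aᵐᵒᵖ {f.lin x} :=
      f.lin.restrict fun y hy => by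
        obtain ⟨a, rfl⟩ := Submodule.mem_span_singleton.1 hy
        rw [map_smul]
        exact Submodule.smul_mem _ _ (Submodule.mem_span_singleton_self _)
    exact Module.Finite.of_injective (g.restrictScalars k) fun y z h =>
      Subtype.ext (injective_of_mono f (congrArg Subtype.val h))
  prop_of_epi {X Y} f _ hX := by
    refine (isTorsion_iff Y).2 fun y => ?_
    obtain ⟨x, rfl⟩ := surjective_of_epi f y
    have := (isTorsion_iff X).1 hX x
    let g : Submodule.span Aᵐᵒᵖ {x} →ₗ[Aᵐᵒᵖ] Submodule.span Aᵐᵒᵖ {f.lin x} :=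
      f.lin.restrict fun y hy => by
        obtain ⟨a, rfl⟩ := Submodule.mem_span_singleton.1 hy
        rw [map_smul]
        exact Submodule.smul_mem _ _ (Submodule.mem_span_singleton_self _)
    refine Module.Finite.of_surjective (g.restrictScalars k) ?_
    rintro ⟨y, hy⟩
    obtain ⟨a, rfl⟩ := Submodule.mem_span_singleton.1 hy
    exact ⟨⟨a • x, Submodule.smul_mem _ _ (Submodule.mem_span_singleton_self _)⟩,
      Subtype.ext (map_smul f.lin a x)⟩
  prop_X₂_of_shortExact {S} hS h₁ h₃ := by
    classical
    have := hS.epi_g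
    have hg := surjective_of_epi S.g
    refine (isTorsion_iff S.X₂).2 fun x => ?_
    obtain ⟨s, hs⟩ := (inferInstance : Algebra.FiniteType k A).out
    have hB := (isTorsion_iff S.X₃).1 h₃ (S.g.lin x)
    set B := Submodule.span Aᵐᵒᵖ {S.g.lin x} with hBdef
    obtain ⟨V₀, hV₀, hVB⟩ : ∃ V₀ : Submodule k S.X₂, V₀.FG ∧
        V₀.map (S.g.lin.restrictScalars k) = B.restrictScalars k := by
      have hfg : (B.restrictScalars k).FG := Module.Finite.iff_fg.1 hB
      obtain ⟨t, ht⟩ := hfg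
      refine ⟨Submodule.span k (Function.surjInv hg '' t),
        ⟨t.image (Function.surjInv hg), by simp⟩, ?_⟩
      rw [Submodule.map_span, ← ht, Set.image_image]
      congr 1
      convert Set.image_id _ using 2
      exact funext fun y => Function.surjInv_eq hg y
    let V := V₀ ⊔ Submodule.span k {x}
    have hV : V.FG := hV₀.sup (Submodule.fg_span_singleton x)
    have hVB' : ∀ v ∈ V, S.g.lin v ∈ B := by
      intro v hv
      obtain ⟨y, hy, z, hz, rfl⟩ := Submodule.mem_sup.1 hv
      obtain ⟨c, rfl⟩ := Submodule.mem_span_singleton.1 hz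
      have h1 : S.g.lin y ∈ B.restrictScalars k := by rw [← hVB]; exact ⟨y, hy, rfl⟩
      have h2 : S.g.lin (c • x) ∈ B := by
        have : S.g.lin (c • x) = c • S.g.lin x := map_smul (S.g.lin.restrictScalars k) c x
        rw [this]
        exact (B.restrictScalars k).smul_mem c (Submodule.mem_span_singleton_self _)
      rw [map_add]
      exact add_mem h1 h2
    obtain ⟨U, hU, hUK, hst⟩ := exists_stable S.X₂ s hs (LinearMap.ker S.g.lin) V hV (by
      intro a _ v hv
      have h1 : op a • S.g.lin v ∈ B.restrictScalars k := B.smul_mem _ (hVB' v hv)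
      rw [← hVB] at h1
      obtain ⟨v', hv', h'⟩ := h1
      have h' : S.g.lin v' = op a • S.g.lin v := h'
      refine ⟨op a • v - v', ?_, ?_⟩
      · rw [LinearMap.mem_ker, map_sub, map_smul, h', sub_self]
      · rw [sub_sub_cancel]; exact Submodule.mem_sup_left hv')
    have hUfin : Module.Finite k U := by
      have hle : U ≤ LinearMap.range S.f.lin := fun y hy => exact_apply hS y (hUK hy)
      have := hS.mono_f
      have hU' : (U.comap S.f.lin).FG := by
        apply Submodule.fg_of_fg_map_injective S.f.lin (injective_of_mono S.f)
        rwa [Submodule.map_comap_eq_of_le hle]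
      have := IsTorsion.finite_of_fg h₁ hU'
      refine Module.Finite.of_surjective
        ((S.f.lin.restrict (p := U.comap S.f.lin) (q := U) fun _ h => h).restrictScalars k) ?_
      rintro ⟨y, hy⟩
      obtain ⟨z, rfl⟩ := hle hy
      exact ⟨⟨z, hy⟩, rfl⟩
    have hW : (V ⊔ U.restrictScalars k).FG := hV.sup (Module.Finite.iff_fg.1 hUfin)
    have hWfin : Module.Finite k (V ⊔ U.restrictScalars k : Submodule k S.X₂) :=
      Module.Finite.iff_fg.2 hW
    have hle : (Submodule.span Aᵐᵒᵖ {x}).restrictScalars k ≤ V ⊔ U.restrictScalars k := by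
      intro y hy
      obtain ⟨a, rfl⟩ := Submodule.mem_span_singleton.1 hy
      exact hst a.unop x (Submodule.mem_sup_left (Submodule.mem_sup_right
        (Submodule.mem_span_singleton_self x)))
    exact Module.Finite.of_injective (Submodule.inclusion hle) (Submodule.inclusion_injective hle)

end Torsion

/-! ### Finitely presented graded modules over a graded coherent algebra -/

end GrMod

/-- A graded algebra is right graded coherent if every finitely generated homogeneous right ideal
is finitely presented. -/
class IsRightGradedCoherent (𝒜 : ℕ → Submodule k A) [GradedAlgebra 𝒜] : Prop where
  finitePresentation_of_fg : ∀ I : Submodule Aᵐᵒᵖ A, I.FG → I.IsHomogeneous 𝒜 →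
    Module.FinitePresentation Aᵐᵒᵖ I

namespace GrMod

variable {𝒜 : ℕ → Submodule k A}

variable (𝒜) in
/-- The full subcategory `gr(A)` of finitely presented modules in `Gr(A)`. -/
def gr : ObjectProperty (GrMod 𝒜) := fun M => Module.FinitePresentation Aᵐᵒᵖ M

section Coherent

/-- Every finitely generated graded submodule is finitely presented. -/
def IsCoh (M : GrMod 𝒜) : Prop :=
  ∀ N : Submodule Aᵐᵒᵖ M, M.IsHomog N → N.FG → Module.FinitePresentation Aᵐᵒᵖ N

lemma IsCoh.prod {M M' : GrMod 𝒜} (hM : M.IsCoh) (hM' : M'.IsCoh) : (M.prod M').IsCoh := by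
  intro N hN hfg
  let p : M.prod M' ⟶ M' := ⟨LinearMap.snd _ _ _, fun _ _ h => h.2⟩
  let j : M ⟶ M.prod M' := ⟨LinearMap.inl _ _ _, fun i _ h => ⟨h, (M'.deg i).zero_mem⟩⟩
  have := hM' (N.map p.lin) (hN.map p) (hfg.map _)
  let l : N →ₗ[Aᵐᵒᵖ] N.map p.lin := p.lin.restrict fun x hx => ⟨x, hx, rfl⟩
  have hl : Function.Surjective l := by
    rintro ⟨_, x, hx, rfl⟩
    exact ⟨⟨x, hx⟩, rfl⟩
  have hNfin : Module.Finite Aᵐᵒᵖ N := Module.Finite.iff_fg.2 hfg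
  have hker := Module.FinitePresentation.fg_ker l hl
  let e : N.comap j.lin ≃ₗ[Aᵐᵒᵖ] LinearMap.ker l :=
    LinearEquiv.ofBijective
      ((j.lin.restrict (p := N.comap j.lin) (q := N) fun x hx => hx).codRestrict (LinearMap.ker l)
        (fun x => Subtype.ext rfl))
      ⟨fun x y h => Subtype.ext (congrArg (fun z : LinearMap.ker l => (z : N).1.1) h), by
        rintro ⟨⟨⟨x, y⟩, hxy⟩, h⟩
        have hy : y = 0 := congrArg Subtype.val h
        subst hy
        exact ⟨⟨x, hxy⟩, rfl⟩⟩
  have hfin : Module.Finite Aᵐᵒᵖ (LinearMap.ker l) := Module.Finite.iff_fg.2 hker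
  have : Module.Finite Aᵐᵒᵖ (N.comap j.lin) := Module.Finite.equiv e.symm
  have := hM (N.comap j.lin) (hN.comap j) (Module.Finite.iff_fg.1 this)
  have : Module.FinitePresentation Aᵐᵒᵖ (LinearMap.ker l) :=
    (LinearEquiv.finitePresentation_iff (M := N.comap j.lin) (N := LinearMap.ker l) e).1 this
  exact Module.finitePresentation_of_ker l hl

lemma IsCoh.of_surjective {M M' : GrMod 𝒜} (hM : M.IsCoh) (f : M ⟶ M')
    (hf : Function.Surjective f.lin) (hk : (LinearMap.ker f.lin).FG) : M'.IsCoh := by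
  intro N hN hfg
  have hle : LinearMap.ker f.lin ≤ N.comap f.lin := fun x hx => by
    rw [Submodule.mem_comap, LinearMap.mem_ker.1 hx]; exact N.zero_mem
  have hfg' : (N.comap f.lin).FG := by
    apply Submodule.fg_of_fg_map_of_fg_inf_ker f.lin
    · rwa [Submodule.map_comap_eq_of_surjective hf]
    · rwa [inf_eq_right.2 hle]
  have := hM _ (hN.comap f) hfg'
  refine Module.finitePresentation_of_surjective
    (f.lin.restrict (p := N.comap f.lin) (q := N) fun x hx => hx) ?_ ?_
  · rintro ⟨y, hy⟩
    obtain ⟨x, rfl⟩ := hf y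
    exact ⟨⟨x, hy⟩, rfl⟩
  · apply Submodule.fg_of_fg_map_injective (N.comap f.lin).subtype Subtype.val_injective
    convert hk
    ext x
    constructor
    · rintro ⟨y, hy, rfl⟩
      exact congrArg Subtype.val hy
    · intro hx
      exact ⟨⟨x, hle hx⟩, Subtype.ext hx, rfl⟩

variable [GradedAlgebra 𝒜]

variable (𝒜) in
/-- The free graded module `A(-d)` on one generator of degree `d`. -/
def free (d : ℤ) : GrMod 𝒜 where
  carrier := A
  deg i := if d ≤ i then 𝒜 (i - d).toNat else ⊥
  isInternal := by
    refine isInternal_of_proj _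
      (fun i => if d ≤ i then GradedAlgebra.proj 𝒜 (i - d).toNat else 0) ?_ ?_ ?_
    · intro i x hx h
      split_ifs at hx h with hi
      · rwa [GradedAlgebra.proj_apply, DirectSum.decompose_of_mem_same _ hx] at h
      · exact hx
    · intro i j x hij hx
      by_cases hi : d ≤ i
      · by_cases hj : d ≤ j
        · rw [if_pos hj] at hx
          rw [if_pos hi, GradedAlgebra.proj_apply, DirectSum.decompose_of_mem_ne _ hx (by omega)]
        · rw [if_neg hj] at hx
          rw [show x = 0 from hx, map_zero]
      · rw [if_neg hi]; rfl
    · intro x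
      refine DirectSum.Decomposition.inductionOn 𝒜 (Submodule.zero_mem _) ?_
        (fun _ _ h h' => Submodule.add_mem _ h h') x
      intro m a
      refine Submodule.mem_iSup_of_mem (d + m) ?_
      rw [if_pos (by omega), show (d + m - d).toNat = m by omega]
      exact a.2
  smul_mem := by
    intro m i a x ha hx
    split_ifs at hx with hi
    · rw [if_pos (by omega), show (i + m - d).toNat = (i - d).toNat + m by omega]
      exact SetLike.mul_mem_graded hx ha
    · rw [show x = 0 from hx, smul_zero]
      exact Submodule.zero_mem _

lemma finite_free (d : ℤ) : Module.Finite Aᵐᵒᵖ (free 𝒜 d) :=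
  Module.Finite.equiv (opLinearEquiv Aᵐᵒᵖ : A ≃ₗ[Aᵐᵒᵖ] Aᵐᵒᵖ).symm

lemma mem_free_deg {d : ℤ} {m : ℕ} {a : A} (ha : a ∈ 𝒜 m) :
    (show (free 𝒜 d).carrier from a) ∈ (free 𝒜 d).deg (d + m) := by
  change a ∈ (if d ≤ d + (m : ℤ) then 𝒜 (d + m - d).toNat else ⊥)
  rw [if_pos (by omega), show (d + m - d).toNat = m by omega]
  exact ha

lemma isCoh_free [IsRightGradedCoherent 𝒜] (d : ℤ) : (free 𝒜 d).IsCoh := by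
  intro N hN hfg
  refine IsRightGradedCoherent.finitePresentation_of_fg (𝒜 := 𝒜) (N : Submodule Aᵐᵒᵖ A) hfg ?_
  intro m x hx
  have key : ∀ x : A, (free 𝒜 d).proj (d + m) x = (DirectSum.decompose 𝒜 x m).1 := by
    intro x
    refine DirectSum.Decomposition.inductionOn 𝒜
      (motive := fun x : A => (free 𝒜 d).proj (d + m) x = (DirectSum.decompose 𝒜 x m).1)
      ?_ ?_ ?_ x
    · rw [DirectSum.decompose_zero]
      exact map_zero ((free 𝒜 d).proj (d + m))
    · intro n a
      by_cases h : m = n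
      · subst h
        rw [DirectSum.decompose_of_mem_same _ a.2]
        exact proj_of_mem (mem_free_deg a.2)
      · rw [DirectSum.decompose_of_mem_ne _ a.2 (Ne.symm h)]
        exact proj_of_mem_ne (by omega) (mem_free_deg a.2)
    · intro x y hx hy
      rw [DirectSum.decompose_add, DirectSum.add_apply, Submodule.coe_add, ← hx, ← hy]
      exact map_add ((free 𝒜 d).proj (d + m)) x y
  rw [← key]
  exact hN.proj_mem hx _

/-- The morphism `A(-d) ⟶ M` given by an element of degree `d`. -/
def freeDesc {M : GrMod 𝒜} {d : ℤ} {x : M} (hx : x ∈ M.deg d) : free 𝒜 d ⟶ M where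
  lin :=
    { toFun := fun a : A => op a • x
      map_add' := fun (a b : A) => by
        change op (a + b) • x = op a • x + op b • x
        rw [MulOpposite.op_add, add_smul]
      map_smul' := fun b (a : A) => by
        change op (a * b.unop) • x = b • op a • x
        rw [MulOpposite.op_mul, mul_smul, op_unop] }
  map_mem i (a : A) ha := by
    change a ∈ (if d ≤ i then 𝒜 (i - d).toNat else ⊥) at ha
    change op a • x ∈ M.deg i
    split_ifs at ha with hi
    · have := M.smul_mem ha hx
      rwa [show d + ((i - d).toNat : ℤ) = i by omega] at this
    · rw [show a = 0 from ha, MulOpposite.op_zero, zero_smul]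
      exact Submodule.zero_mem _

lemma exists_cover [IsRightGradedCoherent 𝒜] (M : GrMod 𝒜) (N : Submodule Aᵐᵒᵖ M) (hN : N.FG) :
    ∃ (F : GrMod 𝒜) (f : F ⟶ M), F.IsCoh ∧ Module.Finite Aᵐᵒᵖ F ∧ N ≤ LinearMap.range f.lin := by
  have hsup : ∀ N N' : Submodule Aᵐᵒᵖ M,
      (∃ (F : GrMod 𝒜) (f : F ⟶ M), F.IsCoh ∧ Module.Finite Aᵐᵒᵖ F ∧ N ≤ LinearMap.range f.lin) →
      (∃ (F : GrMod 𝒜) (f : F ⟶ M), F.IsCoh ∧ Module.Finite Aᵐᵒᵖ F ∧ N' ≤ LinearMap.range f.lin) →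
      ∃ (F : GrMod 𝒜) (f : F ⟶ M), F.IsCoh ∧ Module.Finite Aᵐᵒᵖ F ∧
        N ⊔ N' ≤ LinearMap.range f.lin := by
    rintro N N' ⟨F, f, hF, hFfin, h⟩ ⟨F', f', hF', hF'fin, h'⟩
    refine ⟨F.prod F', ⟨f.lin.coprod f'.lin, fun i x hx =>
      add_mem (f.map_mem i _ hx.1) (f'.map_mem i _ hx.2)⟩, hF.prod hF',
      inferInstanceAs (Module.Finite Aᵐᵒᵖ (F × F')), ?_⟩
    change N ⊔ N' ≤ LinearMap.range (f.lin.coprod f'.lin)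
    rw [LinearMap.range_coprod]
    exact sup_le_sup h h'
  induction N, hN using Submodule.fg_induction with
  | singleton x =>
    refine hom_induction (p := fun x => ∃ (F : GrMod 𝒜) (f : F ⟶ M), F.IsCoh ∧
      Module.Finite Aᵐᵒᵖ F ∧ Submodule.span Aᵐᵒᵖ {x} ≤ LinearMap.range f.lin) x ?_ ?_ ?_
    · exact ⟨free 𝒜 0, 0, isCoh_free 0, finite_free _, by simp⟩
    · intro x y hx hy
      obtain ⟨F, f, hF, hF', h⟩ := hsup _ _ hx hy
      refine ⟨F, f, hF, hF', le_trans ?_ h⟩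
      rw [Submodule.span_singleton_le_iff_mem]
      exact add_mem (Submodule.mem_sup_left (Submodule.mem_span_singleton_self x))
        (Submodule.mem_sup_right (Submodule.mem_span_singleton_self y))
    · intro i x hx
      refine ⟨free 𝒜 i, freeDesc hx, isCoh_free i, finite_free _, ?_⟩
      rw [Submodule.span_singleton_le_iff_mem]
      exact ⟨(1 : A), one_smul _ x⟩
  | sup N N' _ _ h h' => exact hsup N N' h h'

/-- Over a right graded coherent algebra, finitely generated graded submodules of finitely
presented graded modules are finitely presented. -/
lemma isCoh_of_finitePresentation [IsRightGradedCoherent 𝒜] (M : GrMod 𝒜) (hM : gr 𝒜 M) :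
    M.IsCoh := by
  have : Module.FinitePresentation Aᵐᵒᵖ M := hM
  obtain ⟨F, f, hF, hfin, h⟩ := exists_cover M ⊤ Module.Finite.fg_top
  have hf : Function.Surjective f.lin := LinearMap.range_eq_top.1 (top_le_iff.1 h)
  exact hF.of_surjective f hf (Module.FinitePresentation.fg_ker f.lin hf)

/-- Isomorphic objects have linearly equivalent underlying modules. -/
def isoLin {M N : GrMod 𝒜} (e : M ≅ N) : M ≃ₗ[Aᵐᵒᵖ] N :=
  LinearEquiv.ofLinearMap e.hom.lin e.inv.lin (congrArg Hom.lin e.inv_hom_id)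
    (congrArg Hom.lin e.hom_inv_id)

instance : (gr 𝒜).IsClosedUnderIsomorphisms where
  of_iso e (_ : Module.FinitePresentation _ _) := Module.FinitePresentation.of_equiv (isoLin e)

instance : (gr 𝒜).ContainsZero where
  exists_zero := ⟨zero 𝒜, isZero_zero,
    inferInstanceAs (Module.FinitePresentation Aᵐᵒᵖ PUnit.{u + 1})⟩

instance [IsRightGradedCoherent 𝒜] : (gr 𝒜).IsClosedUnderKernels where
  kernels_le := by
    rintro _ ⟨f, c, hc, ⟨hX, hY⟩⟩
    rename_i X Y
    have e := IsLimit.conePointUniqueUpToIso (kernelIsLimit f) hc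
    refine (gr 𝒜).prop_of_iso e ?_
    have : Module.FinitePresentation Aᵐᵒᵖ X := hX
    have := isCoh_of_finitePresentation Y hY (LinearMap.range f.lin) (isHomog_range f)
      (Module.Finite.iff_fg.1 inferInstance)
    have hk := Module.FinitePresentation.fg_ker f.lin.rangeRestrict
      f.lin.surjective_rangeRestrict
    rw [LinearMap.ker_rangeRestrict] at hk
    exact isCoh_of_finitePresentation X hX _ (isHomog_ker f) hk

instance : (gr 𝒜).IsClosedUnderCokernels where
  cokernels_le := by
    rintro _ ⟨f, c, hc, ⟨hX, hY⟩⟩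
    rename_i X Y
    have e := IsColimit.coconePointUniqueUpToIso (cokernelIsColimit f) hc
    refine (gr 𝒜).prop_of_iso e ?_
    have : Module.FinitePresentation Aᵐᵒᵖ X := hX
    have : Module.FinitePresentation Aᵐᵒᵖ Y := hY
    refine Module.finitePresentation_of_surjective (LinearMap.range f.lin).mkQ
      (Submodule.mkQ_surjective _) ?_
    have h : (LinearMap.range f.lin).FG := Module.Finite.iff_fg.1 inferInstance
    rwa [← Submodule.ker_mkQ (LinearMap.range f.lin)] at h

instance : (gr 𝒜).IsClosedUnderFiniteProducts := by
  have : (gr 𝒜).IsClosedUnderBinaryProducts := ⟨by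
    rintro X ⟨p⟩
    let q := (IsLimit.postcomposeHomEquiv (diagramIsoPair p.diag) _).symm p.isLimit
    have e := IsLimit.conePointUniqueUpToIso (prodIsLimit _ _) q
    refine (gr 𝒜).prop_of_iso e ?_
    have h₁ : Module.FinitePresentation Aᵐᵒᵖ (p.diag.obj ⟨.left⟩) := p.prop_diag_obj _
    have h₂ : Module.FinitePresentation Aᵐᵒᵖ (p.diag.obj ⟨.right⟩) := p.prop_diag_obj _
    exact inferInstanceAs
      (Module.FinitePresentation Aᵐᵒᵖ (p.diag.obj ⟨.left⟩ × p.diag.obj ⟨.right⟩))⟩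
  exact .mk'

instance [IsRightGradedCoherent 𝒜] : PreservesFiniteLimits (gr 𝒜).ι :=
  have := (gr 𝒜).preservesKernels_ι
  Functor.preservesFiniteLimits_of_preservesKernels _

instance [IsRightGradedCoherent 𝒜] : PreservesFiniteColimits (gr 𝒜).ι :=
  have := (gr 𝒜).preservesCokernels_ι
  Functor.preservesFiniteColimits_of_preservesCokernels _

end Coherent

/-! ### The quotient categories -/

section Quotients

variable (𝒜) [GradedAlgebra 𝒜]

/-- The full subcategory `tors(A)` of torsion modules in `gr(A)`.  By the closure properties
above, `gr(A)` is abelian when `A` is right graded coherent. -/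
def tors : ObjectProperty (gr 𝒜).FullSubcategory := (Tors 𝒜).inverseImage (gr 𝒜).ι

variable [Algebra.FiniteType k A]

instance [IsRightGradedCoherent 𝒜] : (tors 𝒜).IsSerreClass :=
  inferInstanceAs ((Tors 𝒜).inverseImage (gr 𝒜).ι).IsSerreClass

/-- The quotient category `Qgr(A) = Gr(A) / Tors(A)`. -/
abbrev Qgr := (Tors 𝒜).isoModSerre.Localization

/-- The quotient functor `Gr(A) ⥤ Qgr(A)`. -/
abbrev Qgrπ : GrMod 𝒜 ⥤ Qgr 𝒜 := (Tors 𝒜).isoModSerre.Q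

/-- `Qgr(A)` is an abelian category. -/
noncomputable instance : Abelian (Qgr 𝒜) :=
  ObjectProperty.SerreClassLocalization.abelian (Qgrπ 𝒜) (Tors 𝒜)

variable [IsRightGradedCoherent 𝒜]

/-- The quotient category `qgr(A) = gr(A) / tors(A)`. -/
abbrev qgr := (tors 𝒜).isoModSerre.Localization

/-- The quotient functor `gr(A) ⥤ qgr(A)`. -/
abbrev qgrπ : (gr 𝒜).FullSubcategory ⥤ qgr 𝒜 := (tors 𝒜).isoModSerre.Q

end Quotients

end GrMod

end GradedModules

/-! ### Finitely presented objects -/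

section FinitelyPresented

universe v₁ u₁

variable {C : Type u₁} [Category.{v₁} C]

/-- An object `X` is of finite type if every family of subobjects with sum `X` has a finite
subfamily with sum `X`.  Sums of subobjects are least upper bounds of subobjects. -/
def IsFiniteType (X : C) : Prop :=
  ∀ S : Set (Subobject X), IsLUB S ⊤ → ∃ T ⊆ S, T.Finite ∧ IsLUB T ⊤

variable (C) in
/-- The finitely presented objects: objects `X` of finite type such that the kernel of every
epimorphism `Y ⟶ X` with `Y` of finite type is of finite type. -/
def fp [HasZeroMorphisms C] [HasKernels C] : ObjectProperty C := fun X =>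
  IsFiniteType X ∧ ∀ (Y : C) (p : Y ⟶ X), Epi p → IsFiniteType Y → IsFiniteType (kernel p)

end FinitelyPresented

/-!
Over a finitely generated algebra, a submodule of finite codimension in a finitely generated module
is finitely generated. Hence a morphism `N ⟶ M` of graded modules with torsion kernel and cokernel
and `M` finitely generated is dominated by a finitely generated submodule of `N`, which is again
finitely presented when `M` is, by coherence. So fractions between finitely presented modules can be
computed inside `gr(A)`, and `qgr(A) ⥤ Qgr(A)` is fully faithful.

Subobjects of `π(M)` are represented by homogeneous submodules of `M`, up to torsion. As `M` is the
sum of its finitely generated homogeneous submodules, the objects of finite type are exactly the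
`π(M)` with `M` finitely generated. A finitely presented object is then the cokernel of a map
`π(N) ⟶ π(F)` with `N` finitely generated and `F` finitely presented, which may be taken of the form
`π(g)`. Conversely, if `M` is finitely presented, coherence makes the kernel of every morphism from
a finitely generated module to `M` finitely generated.
-/

/-! ### Modules over finitely generated algebras -/

section LocallyFinite

lemma exists_fg_map_eq_of_le_range {R M N : Type*} [Semiring R] [AddCommMonoid M] [Module R M]
    [AddCommMonoid N] [Module R N] (f : M →ₗ[R] N) {P : Submodule R N} (hP : P.FG)
    (h : P ≤ LinearMap.range f) : ∃ Q : Submodule R M, Q.FG ∧ Q.map f = P := by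
  obtain ⟨t, ht, rfl⟩ := Submodule.fg_def.1 hP
  obtain ⟨t', -, ht', rfl⟩ := ht.exists_subset_finite_image_eq (s := Set.univ) (f := f)
    (by rw [Set.image_univ]; exact Submodule.span_le.1 h)
  exact ⟨_, Submodule.fg_span ht', Submodule.map_span f t'⟩

instance {k R : Type*} [CommSemiring k] [Semiring R] [Algebra k R] [Algebra.FiniteType k R] :
    Algebra.FiniteType k Rᵐᵒᵖ := by
  obtain ⟨s, hs⟩ := Algebra.FiniteType.out (R := k) (A := R)
  refine ⟨s.map opEquiv.toEmbedding, ?_⟩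
  rw [Finset.coe_map, Equiv.coe_toEmbedding, Equiv.image_eq_preimage_symm]
  exact (Subalgebra.op_adjoin (s : Set R)).symm.trans (hs ▸ Subalgebra.op_top)

variable {k R M N : Type*} [CommRing k] [Ring R] [Algebra k R]
  [AddCommGroup M] [Module k M] [Module R M] [IsScalarTower k R M]
  [AddCommGroup N] [Module k N] [Module R N] [IsScalarTower k R N]

lemma smul_mem_of_adjoin_eq_top {s : Set R} (hs : Algebra.adjoin k s = ⊤) {V : Submodule k M}
    (hV : ∀ a ∈ s, ∀ x ∈ V, a • x ∈ V) (a : R) {x : M} (hx : x ∈ V) : a • x ∈ V := by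
  have ha : a ∈ Algebra.adjoin k s := hs ▸ Algebra.mem_top
  induction ha using Algebra.adjoin_induction generalizing x with
  | mem a ha => exact hV a ha x hx
  | algebraMap c => rw [algebraMap_smul]; exact V.smul_mem c hx
  | add a b _ _ iha ihb => rw [add_smul]; exact V.add_mem (iha hx) (ihb hx)
  | mul a b _ _ iha ihb => rw [mul_smul]; exact iha (ihb hx)

lemma eq_top_of_adjoin_eq_top {s : Set R} (hs : Algebra.adjoin k s = ⊤) {V W : Submodule k M}
    (hW : ∀ a ∈ s, ∀ x ∈ W, a • x ∈ W) (hVW : V ≤ W) (hV : Submodule.span R (V : Set M) = ⊤) :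
    W = ⊤ := by
  let W' : Submodule R M :=
    { W with smul_mem' := fun a _ hx => smul_mem_of_adjoin_eq_top hs hW a hx }
  have : Submodule.span R (V : Set M) ≤ W' := Submodule.span_le.2 hVW
  exact eq_top_iff.2 fun x _ => this (hV ▸ Submodule.mem_top)

variable [IsNoetherianRing k]

lemma fg_of_sup_restrictScalars_eq_top [Algebra.FiniteType k R] {V : Submodule k M} (hV : V.FG)
    (hspan : Submodule.span R (V : Set M) = ⊤) {K : Submodule R M}
    (hVK : V ⊔ K.restrictScalars k = ⊤) : K.FG := by
  obtain ⟨s, hs⟩ := Algebra.FiniteType.out (R := k) (A := R)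
  let W : Submodule k M := V ⊔ ⨆ a ∈ s, V.map (DistribSMul.toLinearMap k M a)
  have hW : W.FG := hV.sup (Submodule.fg_biSup s _ fun a _ => hV.map _)
  have hWK : (W ⊓ K.restrictScalars k).FG := hW.of_le inf_le_left
  have hsW : ∀ a ∈ s, ∀ x ∈ V, a • x ∈ W := fun a ha x hx => Submodule.mem_sup_right
    (le_biSup (fun a => V.map (DistribSMul.toLinearMap k M a)) ha (Submodule.mem_map_of_mem hx))
  let K' : Submodule R M := Submodule.span R (W ⊓ K.restrictScalars k : Submodule k M)
  have hK'K : K' ≤ K := Submodule.span_le.2 fun x hx => hx.2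
  have hVK' : V ⊔ K'.restrictScalars k = ⊤ := by
    refine eq_top_of_adjoin_eq_top hs (fun a ha x hx => ?_) le_sup_left hspan
    obtain ⟨v, hv, y, hy, rfl⟩ := Submodule.mem_sup.1 hx
    obtain ⟨v', hv', z, hz, hav⟩ := Submodule.mem_sup.1 (hVK ▸ Submodule.mem_top : a • v ∈ V ⊔ _)
    have hzW : z ∈ W := by
      rw [← add_sub_cancel_left v' z, hav]
      exact sub_mem (hsW a ha v hv) (Submodule.mem_sup_left hv')
    rw [smul_add, ← hav, add_assoc]
    exact Submodule.add_mem_sup hv'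
      (K'.add_mem (Submodule.subset_span ⟨hzW, hz⟩) (K'.smul_mem a hy))
  have hKK' : K ≤ K' := fun x hx => by
    obtain ⟨v, hv, y, hy, rfl⟩ := Submodule.mem_sup.1 (hVK' ▸ Submodule.mem_top : x ∈ V ⊔ _)
    exact K'.add_mem (Submodule.subset_span ⟨Submodule.mem_sup_left hv,
      (K.add_mem_iff_left (hK'K hy)).1 hx⟩) hy
  exact le_antisymm hKK' hK'K ▸ hWK.span

lemma fg_of_finite_quotient [Algebra.FiniteType k R] [Module.Finite R M] (K : Submodule R M)
    [Module.Finite k (M ⧸ K)] : K.FG := by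
  obtain ⟨g, hg⟩ := Module.Finite.fg_top (R := R) (M := M)
  obtain ⟨V, hV, hVK⟩ := exists_fg_map_eq_of_le_range (K.mkQ.restrictScalars k)
    (Module.Finite.fg_top (R := k) (M := M ⧸ K))
    (LinearMap.range_eq_top.2 K.mkQ_surjective).ge
  refine fg_of_sup_restrictScalars_eq_top (k := k) (hV.sup (Submodule.fg_span g.finite_toSet))
    (top_le_iff.1 (hg.ge.trans (Submodule.span_mono fun x hx =>
      Submodule.mem_sup_right (Submodule.subset_span hx)))) (top_le_iff.1 fun x _ => ?_)
  obtain ⟨v, hv, hvx⟩ : K.mkQ x ∈ V.map (K.mkQ.restrictScalars k) := hVK ▸ Submodule.mem_top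
  rw [← add_sub_cancel v x]
  exact Submodule.add_mem_sup (Submodule.mem_sup_left hv)
    ((Submodule.Quotient.eq K).1 hvx.symm)

variable (k R M) in
lemma finitePresentation_of_finite [Algebra.FiniteType k R] [Module.Finite k M] :
    Module.FinitePresentation R M := by
  have : Module.Finite R M := Module.Finite.of_restrictScalars_finite k R M
  obtain ⟨n, f, hf⟩ := Module.Finite.exists_fin' R M
  have : Module.Finite k ((Fin n → R) ⧸ LinearMap.ker f) := Module.Finite.equiv
    ((f.quotKerEquivOfSurjective hf).symm.restrictScalars k)
  exact Module.finitePresentation_of_surjective f hf (fg_of_finite_quotient (k := k) _)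

lemma finite_of_le_of_finite {P Q : Submodule R M} (h : P ≤ Q) [Module.Finite k Q] :
    Module.Finite k P :=
  .of_injective ((Submodule.inclusion h).restrictScalars k) (Submodule.inclusion_injective h)

variable (k R M) in
/-- The largest locally finite submodule of `M`: it consists of the elements which generate an
`R`-submodule that is finitely generated over `k`. -/
def locallyFinitePart : Submodule R M where
  carrier := {x | Module.Finite k (Submodule.span R {x})}
  zero_mem' := by
    change Module.Finite k (Submodule.span R {(0 : M)})
    rw [Submodule.span_zero_singleton]
    infer_instance
  add_mem' {x y} (hx : Module.Finite k (Submodule.span R {x}))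
      (hy : Module.Finite k (Submodule.span R {y})) := by
    have : Module.Finite k ↥(Submodule.span R {x} ⊔ Submodule.span R {y}) := by
      change Module.Finite k ((Submodule.span R {x} ⊔ Submodule.span R {y}).restrictScalars k)
      rw [Submodule.restrictScalars_sup, Module.Finite.iff_fg]
      exact Submodule.FG.sup (Module.Finite.iff_fg.1 hx) (Module.Finite.iff_fg.1 hy)
    exact finite_of_le_of_finite ((Submodule.span_singleton_le_iff_mem _ _).2
      (Submodule.add_mem_sup (Submodule.mem_span_singleton_self x)
        (Submodule.mem_span_singleton_self y)))
  smul_mem' a x (hx : Module.Finite k _) :=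
    finite_of_le_of_finite ((Submodule.span_singleton_le_iff_mem _ _).2
      (Submodule.smul_mem _ a (Submodule.mem_span_singleton_self x)))

lemma le_locallyFinitePart (P : Submodule R M) [Module.Finite k P] :
    P ≤ locallyFinitePart k R M := fun _ hx =>
  finite_of_le_of_finite ((Submodule.span_singleton_le_iff_mem _ _).2 hx)

lemma locallyFinitePart_le_comap (f : M →ₗ[R] N) :
    locallyFinitePart k R M ≤ (locallyFinitePart k R N).comap f := fun x hx => by
  have : Module.Finite k (Submodule.span R {x}) := hx
  have : Module.Finite k ((Submodule.span R {x}).map f) := .of_surjective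
    ((f.submoduleMap (Submodule.span R {x})).restrictScalars k) (f.submoduleMap_surjective _)
  exact le_locallyFinitePart (k := k) ((Submodule.span R {x}).map f)
    (Submodule.mem_map_of_mem (Submodule.mem_span_singleton_self x))

lemma comap_locallyFinitePart (f : M →ₗ[R] N) (hf : Function.Injective f) :
    (locallyFinitePart k R N).comap f = locallyFinitePart k R M := by
  refine le_antisymm (fun x hx => ?_) (locallyFinitePart_le_comap f)
  have : Module.Finite k (Submodule.span R {f x}) := hx
  refine .of_injective ((f.restrict fun y hy => ?_).restrictScalars k :
    Submodule.span R {x} →ₗ[k] Submodule.span R {f x}) fun y z h =>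
      Subtype.ext (hf (congrArg Subtype.val h))
  rw [← Set.image_singleton, ← Submodule.map_span]
  exact Submodule.mem_map_of_mem hy

variable (k) in
/-- The saturation of a submodule `P` of `M`: the preimage of the largest locally finite submodule
of `M ⧸ P`. -/
def saturation (P : Submodule R M) : Submodule R M :=
  (locallyFinitePart k R (M ⧸ P)).comap P.mkQ

lemma le_saturation (P : Submodule R M) : P ≤ saturation k P :=
  P.ker_mkQ.ge.trans (LinearMap.ker_le_comap P.mkQ)

lemma saturation_eq_top_iff {P : Submodule R M} :
    saturation k P = ⊤ ↔ locallyFinitePart k R (M ⧸ P) = ⊤ := by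
  rw [saturation, ← (Submodule.comap_injective_of_surjective P.mkQ_surjective).eq_iff,
    Submodule.comap_top]

end LocallyFinite

/-! ### Induced functors between localizations -/

section Localization

variable {C₁ C₂ D₁ D₂ : Type*} [Category* C₁] [Category* C₂] [Category* D₁] [Category* D₂]
  {W₁ : MorphismProperty C₁} {W₂ : MorphismProperty C₂} (Φ : LocalizerMorphism W₁ W₂)
  (L₁ : C₁ ⥤ D₁) (L₂ : C₂ ⥤ D₂) [L₁.IsLocalization W₁] [L₂.IsLocalization W₂]
  (F : D₁ ⥤ D₂) [CatCommSq Φ.functor L₁ L₂ F] [W₂.HasRightCalculusOfFractions]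

include Φ L₁ L₂

lemma faithful_of_exists_fac [W₁.HasLeftCalculusOfFractions] [Φ.functor.Faithful]
    (hΦ : ∀ ⦃X : C₁⦄ ⦃Y : C₂⦄ (s : Y ⟶ Φ.functor.obj X), W₂ s →
      ∃ (Z : C₁) (u : Z ⟶ X) (t : Φ.functor.obj Z ⟶ Y), W₁ u ∧ t ≫ s = Φ.functor.map u) :
    F.Faithful := by
  let e : L₁ ⋙ F ≅ Φ.functor ⋙ L₂ := (CatCommSq.iso Φ.functor L₁ L₂ F).symm
  have : L₁.EssSurj := Localization.essSurj _ W₁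
  refine F.faithful_of_comp_essSurj L₁ fun X Y f g hfg => ?_
  obtain ⟨φ, rfl, rfl⟩ := Localization.exists_leftFraction₂ L₁ W₁ f g
  have := Localization.inverts L₁ W₁ φ.s φ.hs
  rw [← cancel_mono (L₁.map φ.s), φ.fst.map_comp_map_s L₁, φ.snd.map_comp_map_s L₁]
  have hF : F.map (L₁.map φ.f) = F.map (L₁.map φ.f') := by
    simpa only [← F.map_comp, φ.fst.map_comp_map_s, φ.snd.map_comp_map_s] using
      hfg =≫ F.map (L₁.map φ.s)
  have hL₂ : L₂.map (Φ.functor.map φ.f) = L₂.map (Φ.functor.map φ.f') := by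
    have hf := NatIso.naturality_1 e φ.f
    have hf' := NatIso.naturality_1 e φ.f'
    simp only [Functor.comp_map] at hf hf'
    rw [← hf, ← hf', hF]
  obtain ⟨Y', s, hs, hsφ⟩ := (MorphismProperty.map_eq_iff_precomp L₂ W₂ _ _).1 hL₂
  obtain ⟨Z, u, t, hu, fac⟩ := hΦ s hs
  have huφ : u ≫ φ.f = u ≫ φ.f' := Φ.functor.map_injective (by
    rw [Functor.map_comp, Functor.map_comp, ← fac, Category.assoc, Category.assoc, hsφ])
  have := Localization.inverts L₁ W₁ u hu
  rw [← cancel_epi (L₁.map u), ← L₁.map_comp, ← L₁.map_comp]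
  exact congrArg L₁.map huφ

lemma full_of_exists_fac [Φ.functor.Full]
    (hΦ : ∀ ⦃X : C₁⦄ ⦃Y : C₂⦄ (s : Y ⟶ Φ.functor.obj X), W₂ s →
      ∃ (Z : C₁) (u : Z ⟶ X) (t : Φ.functor.obj Z ⟶ Y), W₁ u ∧ t ≫ s = Φ.functor.map u) :
    F.Full := by
  let e : L₁ ⋙ F ≅ Φ.functor ⋙ L₂ := (CatCommSq.iso Φ.functor L₁ L₂ F).symm
  have : L₁.EssSurj := Localization.essSurj _ W₁
  refine F.full_of_comp_essSurj L₁ fun X Y φ => ?_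
  obtain ⟨ψ, hψ⟩ := Localization.exists_rightFraction L₂ W₂ (e.inv.app X ≫ φ ≫ e.hom.app Y)
  obtain ⟨Z, u, t, hu, fac⟩ := hΦ ψ.s ψ.hs
  obtain ⟨f, hf⟩ := Φ.functor.map_surjective (t ≫ ψ.f)
  have := Localization.inverts L₁ W₁ u hu
  refine ⟨inv (L₁.map u) ≫ L₁.map f, ?_⟩
  have hφ : L₂.map (Φ.functor.map u) ≫ e.inv.app X ≫ φ ≫ e.hom.app Y =
      L₂.map (Φ.functor.map f) := by
    rw [hψ, ← fac, hf, Functor.map_comp, Functor.map_comp, Category.assoc,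
      MorphismProperty.RightFraction.map_s_comp_map]
  have hf' := e.hom.naturality f
  have hu' := e.inv.naturality u
  simp only [Functor.comp_map] at hf' hu'
  rw [Functor.map_comp, Functor.map_inv, IsIso.inv_comp_eq, ← cancel_mono (e.hom.app Y),
    ← cancel_epi (e.inv.app Z), hf', Iso.inv_hom_id_app_assoc, Category.assoc,
    ← reassoc_of% hu', hφ]

end Localization

lemma isoModSerre_inverseImage {C D : Type*} [Category* C] [Category* D] [Abelian C] [Abelian D]
    (F : C ⥤ D) [F.PreservesZeroMorphisms] [PreservesFiniteLimits F] [PreservesFiniteColimits F]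
    (P : ObjectProperty D) [P.IsSerreClass] :
    (P.inverseImage F).isoModSerre = P.isoModSerre.inverseImage F := by
  ext X Y f
  exact and_congr (P.prop_iff_of_iso (PreservesKernel.iso F f))
    (P.prop_iff_of_iso (PreservesCokernel.iso F f))

lemma IsFiniteType.of_iso {C : Type*} [Category* C] {X Y : C} (e : X ≅ Y)
    (hX : IsFiniteType X) : IsFiniteType Y := by
  let φ := Subobject.mapIsoToOrderIso e
  intro S hS
  obtain ⟨T, hTS, hT, hT'⟩ := hX (φ.symm '' S) (by
    have := φ.symm.isLUB_image'.2 hS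
    rwa [map_top] at this)
  refine ⟨φ '' T, ?_, hT.image φ, ?_⟩
  · rintro _ ⟨t, ht, rfl⟩
    obtain ⟨y, hy, rfl⟩ := hTS ht
    rwa [φ.apply_symm_apply]
  · have := φ.isLUB_image'.2 hT'
    rwa [map_top] at this

instance {C : Type*} [Category* C] [HasZeroMorphisms C] [HasKernels C] :
    (fp C).IsClosedUnderIsomorphisms where
  of_iso e hX := ⟨hX.1.of_iso e, fun Z p _ hZ =>
    (hX.2 Z (p ≫ e.inv) inferInstance hZ).of_iso (kernelCompMono p e.inv)⟩

/-! ### Graded modules modulo torsion -/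

namespace GrMod

variable {k : Type w} [Field k] {A : Type u} [Ring A] [Algebra k A] {𝒜 : ℕ → Submodule k A}
  {M N : GrMod 𝒜}

lemma mono_of_injective (f : M ⟶ N) (hf : Function.Injective f.lin) : Mono f :=
  ⟨fun _ _ hgh => hom_ext fun x => hf (congrArg (fun φ => Hom.lin φ x) hgh)⟩

lemma epi_of_surjective (f : M ⟶ N) (hf : Function.Surjective f.lin) : Epi f :=
  ⟨fun _ _ hgh => hom_ext <| hf.forall.2 fun x => congrArg (fun φ => Hom.lin φ x) hgh⟩

instance (P : Submodule Aᵐᵒᵖ M) (hP : M.IsHomog P) : Mono (M.subι P hP) :=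
  mono_of_injective _ Subtype.val_injective

lemma subι_comp_quotπ (P : Submodule Aᵐᵒᵖ M) (hP : M.IsHomog P) :
    M.subι P hP ≫ M.quotπ P hP = 0 :=
  hom_ext fun x => (Submodule.Quotient.mk_eq_zero P).2 x.2

lemma exact_subι_quotπ (P : Submodule Aᵐᵒᵖ M) (hP : M.IsHomog P) :
    (ShortComplex.mk _ _ (subι_comp_quotπ P hP)).Exact :=
  ShortComplex.exact_of_f_is_kernel _ <| KernelFork.IsLimit.ofι' _ _ fun g hg =>
    ⟨subLift g P hP fun x =>
      (Submodule.Quotient.mk_eq_zero P).1 (congrArg (fun φ => Hom.lin φ x) hg), rfl⟩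

lemma range_lin_subι_comp (P : Submodule Aᵐᵒᵖ M) (hP : M.IsHomog P) (f : M ⟶ N) :
    LinearMap.range (M.subι P hP ≫ f).lin = P.map f.lin :=
  (LinearMap.range_comp _ _).trans (congrArg _ P.range_subtype)

/-- The kernel of a morphism is carried by the kernel of the underlying linear map. -/
noncomputable def kernelIso (f : M ⟶ N) : kernel f ≅ M.sub _ (isHomog_ker f) :=
  IsLimit.conePointUniqueUpToIso (kernelIsKernel f) (kernelIsLimit f)

/-- The cokernel of a morphism is carried by the cokernel of the underlying linear map. -/
noncomputable def cokernelIso (f : M ⟶ N) : cokernel f ≅ N.quot _ (isHomog_range f) :=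
  IsColimit.coconePointUniqueUpToIso (cokernelIsCokernel f) (cokernelIsColimit f)

lemma isHomog_iSup {ι : Sort*} {P : ι → Submodule Aᵐᵒᵖ M} (hP : ∀ i, M.IsHomog (P i)) :
    M.IsHomog (⨆ i, P i) := by
  intro j x hx
  change M.proj j x ∈ ⨆ i, P i
  induction hx using Submodule.iSup_induction' with
  | mem i x hx => exact le_iSup P i ((hP i).proj_mem hx j)
  | zero => rw [map_zero]; exact Submodule.zero_mem _
  | add x y _ _ hx hy => rw [map_add]; exact Submodule.add_mem _ hx hy

lemma isHomog_sup {P Q : Submodule Aᵐᵒᵖ M} (hP : M.IsHomog P) (hQ : M.IsHomog Q) :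
    M.IsHomog (P ⊔ Q) := by
  rw [sup_eq_iSup]
  exact isHomog_iSup (Bool.forall_bool.2 ⟨hQ, hP⟩)

lemma gr_cokernel [Module.Finite Aᵐᵒᵖ N] (hM : gr 𝒜 M) (f : N ⟶ M) : gr 𝒜 (cokernel f) := by
  have : Module.FinitePresentation Aᵐᵒᵖ M := hM
  have hf : (LinearMap.range f.lin).mkQ.ker.FG := by
    rw [Submodule.ker_mkQ]
    exact Module.Finite.iff_fg.1 inferInstance
  exact (gr 𝒜).prop_of_iso (cokernelIso f).symm
    (Module.finitePresentation_of_surjective _ (Submodule.mkQ_surjective _) hf)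

variable [GradedAlgebra 𝒜]

lemma exists_isHomog_fg_mem (x : M) :
    ∃ P : Submodule Aᵐᵒᵖ M, M.IsHomog P ∧ P.FG ∧ x ∈ P := by
  refine hom_induction (p := fun x => ∃ P : Submodule Aᵐᵒᵖ M, M.IsHomog P ∧ P.FG ∧ x ∈ P) x
    ⟨Submodule.span Aᵐᵒᵖ {0}, isHomog_span_singleton (i := 0) (Submodule.zero_mem _),
      Submodule.fg_span_singleton 0, Submodule.zero_mem _⟩ ?_
    fun i x hx => ⟨Submodule.span Aᵐᵒᵖ {x}, isHomog_span_singleton hx,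
      Submodule.fg_span_singleton x, Submodule.mem_span_singleton_self x⟩
  rintro x y ⟨P, hP, hPfg, hx⟩ ⟨Q, hQ, hQfg, hy⟩
  exact ⟨P ⊔ Q, isHomog_sup hP hQ, hPfg.sup hQfg, Submodule.add_mem_sup hx hy⟩

lemma exists_isHomog_fg_ge {P : Submodule Aᵐᵒᵖ M} (hP : P.FG) :
    ∃ Q : Submodule Aᵐᵒᵖ M, M.IsHomog Q ∧ Q.FG ∧ P ≤ Q := by
  induction P, hP using Submodule.fg_induction with
  | singleton x =>
    obtain ⟨Q, hQ, hQfg, hx⟩ := exists_isHomog_fg_mem x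
    exact ⟨Q, hQ, hQfg, (Submodule.span_singleton_le_iff_mem _ _).2 hx⟩
  | sup P₁ P₂ _ _ h₁ h₂ =>
    obtain ⟨Q₁, hQ₁, hfg₁, h₁⟩ := h₁
    obtain ⟨Q₂, hQ₂, hfg₂, h₂⟩ := h₂
    exact ⟨Q₁ ⊔ Q₂, isHomog_sup hQ₁ hQ₂, hfg₁.sup hfg₂, sup_le_sup h₁ h₂⟩

lemma isTorsion_iff_locallyFinitePart_eq_top :
    M.IsTorsion ↔ locallyFinitePart k Aᵐᵒᵖ M = ⊤ :=
  M.isTorsion_iff.trans (Submodule.eq_top_iff' (p := locallyFinitePart k Aᵐᵒᵖ M)).symm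

lemma finite_of_isTorsion [Module.Finite Aᵐᵒᵖ M] (hM : M.IsTorsion) : Module.Finite k M :=
  have := hM.finite_of_fg (Module.Finite.fg_top (R := Aᵐᵒᵖ) (M := M))
  Module.Finite.equiv ((Submodule.topEquiv (R := Aᵐᵒᵖ) (M := M)).restrictScalars k)

lemma isTorsion_sub_iff {P : Submodule Aᵐᵒᵖ M} {hP : M.IsHomog P} :
    (M.sub P hP).IsTorsion ↔ P ≤ locallyFinitePart k Aᵐᵒᵖ M := by
  rw [isTorsion_iff_locallyFinitePart_eq_top, ← Submodule.comap_subtype_eq_top,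
    comap_locallyFinitePart P.subtype P.subtype_injective]
  rfl

lemma isTorsion_quot_iff {P : Submodule Aᵐᵒᵖ M} {hP : M.IsHomog P} :
    (M.quot P hP).IsTorsion ↔ saturation k P = ⊤ :=
  isTorsion_iff_locallyFinitePart_eq_top.trans saturation_eq_top_iff.symm

lemma fg_ker [IsRightGradedCoherent 𝒜] [Module.Finite Aᵐᵒᵖ N] (hM : gr 𝒜 M) (f : N ⟶ M) :
    (LinearMap.ker f.lin).FG := by
  have := isCoh_of_finitePresentation M hM _ (isHomog_range f)
    (Module.Finite.iff_fg.1 inferInstance)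
  rw [← LinearMap.ker_rangeRestrict]
  exact Module.FinitePresentation.fg_ker _ f.lin.surjective_rangeRestrict

lemma exists_gr_epi [IsRightGradedCoherent 𝒜] (M : GrMod 𝒜) [Module.Finite Aᵐᵒᵖ M] :
    ∃ (F : GrMod 𝒜) (f : F ⟶ M), gr 𝒜 F ∧ Epi f := by
  obtain ⟨F, f, hF, hfin, hf⟩ := exists_cover M ⊤ Module.Finite.fg_top
  have := hF ⊤ F.isHomog_top Module.Finite.fg_top
  exact ⟨F, f, Module.FinitePresentation.of_equiv Submodule.topEquiv,
    epi_of_surjective f (LinearMap.range_eq_top.1 (top_le_iff.1 hf))⟩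

variable [Algebra.FiniteType k A]

lemma fg_of_saturation_eq_top [Module.Finite Aᵐᵒᵖ M] {P : Submodule Aᵐᵒᵖ M} (hP : M.IsHomog P)
    (h : saturation k P = ⊤) : P.FG := by
  have : Module.Finite Aᵐᵒᵖ (M.quot P hP) := inferInstanceAs (Module.Finite Aᵐᵒᵖ (M ⧸ P))
  have : Module.Finite k (M ⧸ P) := finite_of_isTorsion (isTorsion_quot_iff (hP := hP).2 h)
  exact fg_of_finite_quotient (k := k) P

lemma monoModSerre_iff (f : M ⟶ N) :
    (Tors 𝒜).monoModSerre f ↔ LinearMap.ker f.lin ≤ locallyFinitePart k Aᵐᵒᵖ M :=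
  ((Tors 𝒜).prop_iff_of_iso (kernelIso f)).trans isTorsion_sub_iff

lemma epiModSerre_iff (f : M ⟶ N) :
    (Tors 𝒜).epiModSerre f ↔ saturation k (LinearMap.range f.lin) = ⊤ :=
  ((Tors 𝒜).prop_iff_of_iso (cokernelIso f)).trans isTorsion_quot_iff

lemma exists_finite_of_isoModSerre [Module.Finite Aᵐᵒᵖ M] (s : N ⟶ M)
    (hs : (Tors 𝒜).isoModSerre s) :
    ∃ (N' : GrMod 𝒜) (t : N' ⟶ N), Module.Finite Aᵐᵒᵖ N' ∧ (Tors 𝒜).isoModSerre (t ≫ s) := by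
  have hsat := (epiModSerre_iff s).1 hs.2
  obtain ⟨Q, hQ, hQs⟩ := exists_fg_map_eq_of_le_range s.lin
    (fg_of_saturation_eq_top (isHomog_range s) hsat) le_rfl
  obtain ⟨P, hP, hPfg, hQP⟩ := exists_isHomog_fg_ge hQ
  have hPs : LinearMap.range (N.subι P hP ≫ s).lin = LinearMap.range s.lin :=
    (range_lin_subι_comp P hP s).trans
      (LinearMap.map_le_range.antisymm (hQs.ge.trans (Submodule.map_mono hQP)))
  refine ⟨N.sub P hP, N.subι P hP, Module.Finite.iff_fg.2 hPfg, ?_, ?_⟩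
  · exact (Tors 𝒜).monoModSerre.comp_mem _ _ ((Tors 𝒜).monoModSerre_of_mono _) hs.1
  · rwa [epiModSerre_iff, hPs]

variable [IsRightGradedCoherent 𝒜]

lemma gr_of_monoModSerre [Module.Finite Aᵐᵒᵖ N] (hM : gr 𝒜 M) {f : N ⟶ M}
    (hf : (Tors 𝒜).monoModSerre f) : gr 𝒜 N := by
  have := isCoh_of_finitePresentation M hM _ (isHomog_range f)
    (Module.Finite.iff_fg.1 inferInstance)
  have : Module.Finite Aᵐᵒᵖ (N.sub _ (isHomog_ker f)) := Module.Finite.iff_fg.2 (fg_ker hM f)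
  have : Module.Finite k (N.sub _ (isHomog_ker f)) :=
    finite_of_isTorsion (isTorsion_sub_iff.2 ((monoModSerre_iff f).1 hf))
  have : Module.FinitePresentation Aᵐᵒᵖ (LinearMap.ker f.lin.rangeRestrict) := by
    rw [LinearMap.ker_rangeRestrict]
    exact finitePresentation_of_finite k Aᵐᵒᵖ (N.sub _ (isHomog_ker f))
  exact Module.finitePresentation_of_ker _ f.lin.surjective_rangeRestrict

lemma exists_gr_of_isoModSerre (hM : gr 𝒜 M) (s : N ⟶ M) (hs : (Tors 𝒜).isoModSerre s) :
    ∃ (N' : GrMod 𝒜) (t : N' ⟶ N), gr 𝒜 N' ∧ (Tors 𝒜).isoModSerre (t ≫ s) := by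
  have : Module.FinitePresentation Aᵐᵒᵖ M := hM
  obtain ⟨N', t, _, ht⟩ := exists_finite_of_isoModSerre s hs
  exact ⟨N', t, gr_of_monoModSerre hM ht.1, ht⟩

end GrMod

/-! ### Subobjects and finitely presented objects of `Qgr(A)` -/

namespace GrMod

variable {k : Type w} [Field k] {A : Type u} [Ring A] [Algebra k A] {𝒜 : ℕ → Submodule k A}
  {M N : GrMod 𝒜}

/-- The homogeneous submodules of a graded module. -/
structure HomogSubmodule (M : GrMod 𝒜) extends Submodule Aᵐᵒᵖ M where
  isHomog : M.IsHomog toSubmodule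

namespace HomogSubmodule

/-- The sum of a set of homogeneous submodules. -/
def sum (S : Set M.HomogSubmodule) : M.HomogSubmodule :=
  ⟨⨆ P ∈ S, P.toSubmodule, isHomog_iSup fun P => isHomog_iSup fun _ => P.isHomog⟩

lemma exists_finset_sum_le {S : Set M.HomogSubmodule} (hS : (sum S).FG) :
    ∃ T : Finset M.HomogSubmodule, ↑T ⊆ S ∧
      (sum S).toSubmodule ≤ (sum (T : Set M.HomogSubmodule)).toSubmodule := by
  classical
  obtain ⟨T, hT⟩ := CompleteLattice.IsCompactElement.exists_finset_of_le_iSup _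
    ((Submodule.fg_iff_compact _).1 hS) (fun P : S => P.1.toSubmodule) iSup_subtype'.le
  refine ⟨T.image Subtype.val, by simp, hT.trans (iSup₂_le fun P hP => ?_)⟩
  exact le_biSup toSubmodule (Finset.mem_coe.2 (Finset.mem_image_of_mem _ hP))

end HomogSubmodule

variable [GradedAlgebra 𝒜] [Algebra.FiniteType k A]

instance : PreservesFiniteLimits (Qgrπ 𝒜) :=
  ObjectProperty.SerreClassLocalization.preservesFiniteLimits (Qgrπ 𝒜) (Tors 𝒜)

instance : PreservesFiniteColimits (Qgrπ 𝒜) :=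
  ObjectProperty.SerreClassLocalization.preservesFiniteColimits (Qgrπ 𝒜) (Tors 𝒜)

instance : (Qgrπ 𝒜).EssSurj := Localization.essSurj _ (Tors 𝒜).isoModSerre

lemma isIso_Qgrπ_map_iff (f : M ⟶ N) : IsIso ((Qgrπ 𝒜).map f) ↔ (Tors 𝒜).isoModSerre f :=
  ObjectProperty.SerreClassLocalization.isIso_map_iff (Qgrπ 𝒜) (Tors 𝒜) f

lemma Qgrπ_map_eq_zero_iff (f : M ⟶ N) :
    (Qgrπ 𝒜).map f = 0 ↔ LinearMap.range f.lin ≤ locallyFinitePart k Aᵐᵒᵖ N := by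
  let p : M ⟶ N.sub _ (isHomog_range f) := subLift f _ _ fun x => ⟨x, rfl⟩
  have : Epi p := epi_of_surjective p f.lin.surjective_rangeRestrict
  have := strongEpi_of_epi p
  rw [ObjectProperty.SerreClassLocalization.map_eq_zero_iff (Qgrπ 𝒜) (Tors 𝒜)]
  exact ((Tors 𝒜).prop_iff_of_iso (Abelian.imageIsoImage f ≪≫
    (image.isoStrongEpiMono p (N.subι _ (isHomog_range f)) rfl).symm)).trans isTorsion_sub_iff

namespace HomogSubmodule

/-- The subobject of `π(M)` given by a homogeneous submodule of `M`. -/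
noncomputable def subobject (P : M.HomogSubmodule) : Subobject ((Qgrπ 𝒜).obj M) :=
  Subobject.mk ((Qgrπ 𝒜).map (M.subι P.toSubmodule P.isHomog))

lemma subobject_le_iff {P Q : M.HomogSubmodule} :
    P.subobject ≤ Q.subobject ↔ P.toSubmodule ≤ saturation k Q.toSubmodule := by
  have hQ := (exact_subι_quotπ _ Q.isHomog).map (Qgrπ 𝒜)
  have : Mono ((ShortComplex.mk _ _ (subι_comp_quotπ _ Q.isHomog)).map (Qgrπ 𝒜)).f :=
    inferInstanceAs (Mono ((Qgrπ 𝒜).map (M.subι _ Q.isHomog)))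
  calc P.subobject ≤ Q.subobject
      ↔ (Qgrπ 𝒜).map (M.subι _ P.isHomog) ≫ (Qgrπ 𝒜).map (M.quotπ _ Q.isHomog) = 0 := by
        refine ⟨fun h => ?_, fun h => Subobject.mk_le_mk_of_comm (hQ.lift _ h) (hQ.lift_f _ h)⟩
        rw [← Subobject.ofMkLEMk_comp h, Category.assoc, ← Functor.map_comp, subι_comp_quotπ,
          Functor.map_zero, comp_zero]
    _ ↔ P.toSubmodule.map Q.toSubmodule.mkQ ≤ locallyFinitePart k Aᵐᵒᵖ (M ⧸ Q.toSubmodule) := by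
        rw [← Functor.map_comp, Qgrπ_map_eq_zero_iff, range_lin_subι_comp]
        rfl
    _ ↔ P.toSubmodule ≤ saturation k Q.toSubmodule := Submodule.map_le_iff_le_comap

lemma subobject_mono {P Q : M.HomogSubmodule} (h : P.toSubmodule ≤ Q.toSubmodule) :
    P.subobject ≤ Q.subobject :=
  subobject_le_iff.2 (h.trans (le_saturation _))

lemma subobject_top : subobject ⟨⊤, M.isHomog_top⟩ = ⊤ := by
  have : IsIso (M.subι ⊤ M.isHomog_top) := ⟨subLift (𝟙 M) _ _ fun _ => trivial, rfl, rfl⟩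
  exact (Subobject.isIso_iff_mk_eq_top _).1 inferInstance

lemma subobject_eq_top_iff {P : M.HomogSubmodule} :
    P.subobject = ⊤ ↔ saturation k P.toSubmodule = ⊤ := by
  rw [← top_le_iff, ← subobject_top, subobject_le_iff, top_le_iff]

lemma subobject_surjective : Function.Surjective (subobject (M := M)) := by
  intro S
  obtain ⟨φ, hφ⟩ := Localization.exists_rightFraction (Qgrπ 𝒜) (Tors 𝒜).isoModSerre
    (((Qgrπ 𝒜).objObjPreimageIso (S : Qgr 𝒜)).hom ≫ S.arrow)
  have hs : IsIso ((Qgrπ 𝒜).map φ.s) := (isIso_Qgrπ_map_iff _).2 φ.hs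
  rw [← cancel_epi ((Qgrπ 𝒜).map φ.s),
    MorphismProperty.RightFraction.map_s_comp_map] at hφ
  refine ⟨⟨_, isHomog_range φ.f⟩, ?_⟩
  let p : φ.X' ⟶ M.sub _ (isHomog_range φ.f) := subLift φ.f _ _ fun x => ⟨x, rfl⟩
  have hp : (Qgrπ 𝒜).map p ≫ (Qgrπ 𝒜).map (M.subι _ (isHomog_range φ.f)) =
    (Qgrπ 𝒜).map φ.f := ((Qgrπ 𝒜).map_comp _ _).symm
  have : Epi p := epi_of_surjective p φ.f.lin.surjective_rangeRestrict
  have : Mono ((Qgrπ 𝒜).map φ.f) := by rw [← hφ]; infer_instance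
  have : Mono ((Qgrπ 𝒜).map p) := mono_of_mono_fac hp
  have : IsIso ((Qgrπ 𝒜).map p) := isIso_of_mono_of_epi _
  refine (Subobject.mk_eq_mk_of_comm _ S.arrow ((asIso ((Qgrπ 𝒜).map p)).symm ≪≫
    asIso ((Qgrπ 𝒜).map φ.s) ≪≫ (Qgrπ 𝒜).objObjPreimageIso (S : Qgr 𝒜)) ?_).trans
    (Subobject.mk_arrow S)
  simp only [Iso.trans_hom, Iso.symm_hom, asIso_inv, asIso_hom, Category.assoc]
  rw [IsIso.inv_comp_eq, hp, hφ]

lemma isLUB_subobject_image_iff {S : Set M.HomogSubmodule} :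
    IsLUB (subobject '' S) ⊤ ↔ saturation k (sum S).toSubmodule = ⊤ := by
  constructor
  · intro h
    refine subobject_eq_top_iff.1 (top_le_iff.1 (h.2 ?_))
    rintro _ ⟨P, hP, rfl⟩
    exact subobject_mono (le_biSup toSubmodule hP)
  · intro h
    refine ⟨fun _ _ => le_top, fun B hB => ?_⟩
    obtain ⟨Q, rfl⟩ := subobject_surjective B
    rw [← subobject_eq_top_iff.2 h, subobject_le_iff]
    exact iSup₂_le fun P hP => subobject_le_iff.1 (hB ⟨P, hP, rfl⟩)

end HomogSubmodule

open HomogSubmodule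

lemma isFiniteType_Qgrπ_obj (M : GrMod 𝒜) [Module.Finite Aᵐᵒᵖ M] :
    IsFiniteType ((Qgrπ 𝒜).obj M) := by
  intro S hS
  obtain ⟨S, rfl⟩ := subobject_surjective.image_surjective S
  rw [isLUB_subobject_image_iff] at hS
  have hfg := fg_of_saturation_eq_top (sum S).isHomog hS
  obtain ⟨T, hTS, hT⟩ := exists_finset_sum_le hfg
  refine ⟨subobject '' T, Set.image_mono hTS, T.finite_toSet.image _, ?_⟩
  rw [← subobject_eq_top_iff] at hS
  rw [isLUB_subobject_image_iff, ← subobject_eq_top_iff]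
  exact top_le_iff.1 (hS.ge.trans (subobject_mono hT))

lemma exists_finite_iso_of_isFiniteType {X : Qgr 𝒜} (hX : IsFiniteType X) :
    ∃ M : GrMod 𝒜, Module.Finite Aᵐᵒᵖ M ∧ Nonempty ((Qgrπ 𝒜).obj M ≅ X) := by
  let M := (Qgrπ 𝒜).objPreimage X
  let e : (Qgrπ 𝒜).obj M ≅ X := (Qgrπ 𝒜).objObjPreimageIso X
  let S : Set M.HomogSubmodule := {P | P.FG}
  have hS : (sum S).toSubmodule = ⊤ := top_le_iff.1 fun x _ => by
    obtain ⟨P, hP, hPfg, hx⟩ := exists_isHomog_fg_mem x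
    exact le_biSup toSubmodule (show (⟨P, hP⟩ : M.HomogSubmodule) ∈ S from hPfg) hx
  obtain ⟨U, hUS, hU, hUtop⟩ := hX.of_iso e.symm (subobject '' S)
    (isLUB_subobject_image_iff.2 (top_le_iff.1 (hS.ge.trans (le_saturation _))))
  obtain ⟨T, hTS, hT, rfl⟩ := hU.exists_subset_finite_image_eq hUS
  have hfg : (sum T).FG := by
    rw [← hT.coe_toFinset]
    exact Submodule.fg_biSup _ _ fun P hP => hTS (hT.mem_toFinset.1 hP)
  have : IsIso ((Qgrπ 𝒜).map (M.subι _ (sum T).isHomog)) := (Subobject.isIso_iff_mk_eq_top _).2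
    (subobject_eq_top_iff.2 (isLUB_subobject_image_iff.1 hUtop))
  exact ⟨M.sub _ (sum T).isHomog, Module.Finite.iff_fg.2 hfg,
    ⟨asIso ((Qgrπ 𝒜).map (M.subι _ (sum T).isHomog)) ≪≫ e⟩⟩

lemma exists_finite_iso_comp_eq {Y : Qgr 𝒜} (hY : IsFiniteType Y) (p : Y ⟶ (Qgrπ 𝒜).obj M) :
    ∃ (N : GrMod 𝒜) (e : (Qgrπ 𝒜).obj N ≅ Y) (g : N ⟶ M), Module.Finite Aᵐᵒᵖ N ∧
      e.hom ≫ p = (Qgrπ 𝒜).map g := by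
  obtain ⟨L, hL, ⟨e⟩⟩ := exists_finite_iso_of_isFiniteType hY
  obtain ⟨φ, hφ⟩ := Localization.exists_rightFraction (Qgrπ 𝒜) (Tors 𝒜).isoModSerre (e.hom ≫ p)
  obtain ⟨N, t, hN, ht⟩ := exists_finite_of_isoModSerre φ.s φ.hs
  have : IsIso ((Qgrπ 𝒜).map (t ≫ φ.s)) := (isIso_Qgrπ_map_iff _).2 ht
  refine ⟨N, asIso ((Qgrπ 𝒜).map (t ≫ φ.s)) ≪≫ e, t ≫ φ.f, hN, ?_⟩
  rw [Iso.trans_hom, asIso_hom, Category.assoc, hφ, Functor.map_comp, Category.assoc,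
    MorphismProperty.RightFraction.map_s_comp_map, ← Functor.map_comp]

variable [IsRightGradedCoherent 𝒜]

lemma fp_Qgrπ_obj (hM : gr 𝒜 M) : fp (Qgr 𝒜) ((Qgrπ 𝒜).obj M) := by
  have : Module.FinitePresentation Aᵐᵒᵖ M := hM
  refine ⟨isFiniteType_Qgrπ_obj M, fun Y p _ hY => ?_⟩
  obtain ⟨N, e, g, _, hg⟩ := exists_finite_iso_comp_eq hY p
  have : Module.Finite Aᵐᵒᵖ (N.sub _ (isHomog_ker g)) := Module.Finite.iff_fg.2 (fg_ker hM g)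
  exact (isFiniteType_Qgrπ_obj (N.sub _ (isHomog_ker g))).of_iso <|
    (Qgrπ 𝒜).mapIso (kernelIso g).symm ≪≫ PreservesKernel.iso (Qgrπ 𝒜) g ≪≫
      kernelIsoOfEq hg.symm ≪≫ kernelIsIsoComp e.hom p

lemma exists_gr_iso_of_fp {X : Qgr 𝒜} (hX : fp (Qgr 𝒜) X) :
    ∃ M : GrMod 𝒜, gr 𝒜 M ∧ Nonempty ((Qgrπ 𝒜).obj M ≅ X) := by
  obtain ⟨M, _, ⟨e⟩⟩ := exists_finite_iso_of_isFiniteType hX.1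
  obtain ⟨F, f, hF, _⟩ := exists_gr_epi M
  have : Module.FinitePresentation Aᵐᵒᵖ F := hF
  let q := (Qgrπ 𝒜).map f ≫ e.hom
  have hK : IsFiniteType (kernel q) := hX.2 _ q inferInstance (isFiniteType_Qgrπ_obj F)
  obtain ⟨N, e', g, _, hg⟩ := exists_finite_iso_comp_eq hK (kernel.ι q)
  exact ⟨cokernel g, gr_cokernel hF g, ⟨PreservesCokernel.iso (Qgrπ 𝒜) g ≪≫
    cokernelIsoOfEq hg.symm ≪≫ cokernelEpiComp e'.hom (kernel.ι q) ≪≫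
    (cokernelIsCokernel (kernel.ι q)).coconePointUniqueUpToIso
      (Abelian.epiIsCokernelOfKernel _ (limit.isLimit _))⟩⟩

end GrMod

/-! ### The functor `qgr(A) ⥤ Qgr(A)` -/

namespace GrMod

variable {k : Type w} [Field k] {A : Type u} [Ring A] [Algebra k A] (𝒜 : ℕ → Submodule k A)
  [GradedAlgebra 𝒜] [Algebra.FiniteType k A] [IsRightGradedCoherent 𝒜]

/-- The inclusion `gr(A) ⥤ Gr(A)`, which carries isomorphisms modulo `tors(A)` to isomorphisms
modulo `Tors(A)`. -/
def grLocalizerMorphism : LocalizerMorphism (tors 𝒜).isoModSerre (Tors 𝒜).isoModSerre :=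
  .ofEq (isoModSerre_inverseImage (gr 𝒜).ι (Tors 𝒜))

/-- The functor `qgr(A) ⥤ Qgr(A)` induced by the inclusion `gr(A) ⥤ Gr(A)`. -/
noncomputable def qgrToQgr : qgr 𝒜 ⥤ Qgr 𝒜 :=
  (grLocalizerMorphism 𝒜).localizedFunctor (qgrπ 𝒜) (Qgrπ 𝒜)

noncomputable instance :
    CatCommSq (grLocalizerMorphism 𝒜).functor (qgrπ 𝒜) (Qgrπ 𝒜) (qgrToQgr 𝒜) :=
  inferInstanceAs (CatCommSq _ _ _ ((grLocalizerMorphism 𝒜).localizedFunctor _ _))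

/-- The compatibility of `qgr(A) ⥤ Qgr(A)` with the quotient functors. -/
noncomputable def qgrπCompQgrToQgrIso : qgrπ 𝒜 ⋙ qgrToQgr 𝒜 ≅ (gr 𝒜).ι ⋙ Qgrπ 𝒜 :=
  (CatCommSq.iso (grLocalizerMorphism 𝒜).functor (qgrπ 𝒜) (Qgrπ 𝒜) (qgrToQgr 𝒜)).symm

variable {𝒜} in
lemma exists_fac_of_isoModSerre {M : (gr 𝒜).FullSubcategory} {N : GrMod 𝒜}
    (s : N ⟶ (gr 𝒜).ι.obj M) (hs : (Tors 𝒜).isoModSerre s) :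
    ∃ (N' : (gr 𝒜).FullSubcategory) (u : N' ⟶ M) (t : (gr 𝒜).ι.obj N' ⟶ N),
      (tors 𝒜).isoModSerre u ∧ t ≫ s = (gr 𝒜).ι.map u := by
  obtain ⟨N', t, hN', ht⟩ := exists_gr_of_isoModSerre M.property s hs
  let u : (⟨N', hN'⟩ : (gr 𝒜).FullSubcategory) ⟶ M := ObjectProperty.homMk (t ≫ s)
  refine ⟨_, u, t, ?_, rfl⟩
  rw [show (tors 𝒜).isoModSerre = _ from isoModSerre_inverseImage (gr 𝒜).ι (Tors 𝒜)]
  exact ht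

instance : (qgrToQgr 𝒜).Faithful :=
  have : (grLocalizerMorphism 𝒜).functor.Faithful := inferInstanceAs (gr 𝒜).ι.Faithful
  faithful_of_exists_fac (grLocalizerMorphism 𝒜) (qgrπ 𝒜) (Qgrπ 𝒜) _
    fun _ _ => exists_fac_of_isoModSerre

instance : (qgrToQgr 𝒜).Full :=
  have : (grLocalizerMorphism 𝒜).functor.Full := inferInstanceAs (gr 𝒜).ι.Full
  full_of_exists_fac (grLocalizerMorphism 𝒜) (qgrπ 𝒜) (Qgrπ 𝒜) _
    fun _ _ => exists_fac_of_isoModSerre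

lemma essImage_qgrToQgr : (qgrToQgr 𝒜).essImage = fp (Qgr 𝒜) := by
  have : (qgrπ 𝒜).EssSurj := Localization.essSurj _ (tors 𝒜).isoModSerre
  refine le_antisymm ?_ fun X hX => ?_
  · rintro X ⟨Y, ⟨e⟩⟩
    let M := (qgrπ 𝒜).objPreimage Y
    exact (fp (Qgr 𝒜)).prop_of_iso ((qgrπCompQgrToQgrIso 𝒜).symm.app M ≪≫
      (qgrToQgr 𝒜).mapIso ((qgrπ 𝒜).objObjPreimageIso Y) ≪≫ e) (fp_Qgrπ_obj M.property)
  · obtain ⟨M, hM, ⟨e⟩⟩ := exists_gr_iso_of_fp hX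
    exact ⟨(qgrπ 𝒜).obj ⟨M, hM⟩, ⟨(qgrπCompQgrToQgrIso 𝒜).app ⟨M, hM⟩ ≪≫ e⟩⟩

end GrMod

theorem mainTheorem6 {k : Type w} [Field k] {A : Type u} [Ring A] [Algebra k A]
    (𝒜 : ℕ → Submodule k A) [GradedAlgebra 𝒜] [Algebra.FiniteType k A]
    [IsRightGradedCoherent 𝒜] :
    ∃ E : GrMod.qgr 𝒜 ≌ (fp (GrMod.Qgr 𝒜)).FullSubcategory,
      Nonempty (GrMod.qgrπ 𝒜 ⋙ E.functor ⋙ (fp (GrMod.Qgr 𝒜)).ι ≅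
        (GrMod.gr 𝒜).ι ⋙ GrMod.Qgrπ 𝒜) := by
  let E : GrMod.qgr 𝒜 ≌ (fp (GrMod.Qgr 𝒜)).FullSubcategory :=
    (GrMod.qgrToQgr 𝒜).toEssImage.asEquivalence.trans
      (ObjectProperty.fullSubcategoryCongr (GrMod.essImage_qgrToQgr 𝒜))
  exact ⟨E, ⟨GrMod.qgrπCompQgrToQgrIso 𝒜⟩⟩
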